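/- Let $r,n,d\ge 1$ be integers, let $\zeta=e^{2\pi i/r}$, let $q$ be an indeterminate, and let $\mathcal R=\mathbb Z[\tfrac1r][q,q^{-1},\zeta]$. Let $A$ be a nonzero commutative $\mathcal R$-algebra and let $v_1,\dots,v_d$ be invertible elements of $A$ (for example $A=\mathcal R[v_1^{\pm1},\dots,v_d^{\pm1}]$ with $v_1,\dots,v_d$ indeterminates, or $A=\mathcal R$ with $v_i\in\mathcal R^\times$). The affine Yokonuma–Hecke algebra $\widehat Y_{r,n}$ over $A$ is the associative unital $A$-algebra generated by $t_1,\dots,t_n,g_1,\dots,g_{n-1},X_1^{\pm1}$ with the relations $$\begin{aligned} &g_ig_j=g_jg_i\ (|i-j|\ge2),\qquad g_ig_{i+1}g_i=g_{i+1}g_ig_{i+1},\qquad t_it_j=t_jt_i,\\ &g_it_j=t_{s_i(j)}g_i,\qquad t_i^r=1,\qquad g_i^2=1+(q-q^{-1})e_ig_i,\\ &X_1X_1^{-1}=X_1^{-1}X_1=1,\qquad g_1X_1g_1X_1=X_1g_1X_1g_1,\\ &g_iX_1=X_1g_i\ (i\ge 2),\qquad t_jX_1=X_1t_j, \end{aligned}$$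 where $s_i=(i,i+1)$ and $e_i=\frac1r\sum_{s=0}^{r-1}t_i^st_{i+1}^{-s}$. Put $X_{i+1}=g_iX_ig_i$ for $1\le i\le n-1$, and $X^\alpha=X_1^{\alpha_1}\cdots X_n^{\alpha_n}$, $t^\beta=t_1^{\beta_1}\cdots t_n^{\beta_n}$ for $\alpha,\beta\in\mathbb Z_{\ge0}^n$. For each $w\in\mathfrak S_n$ choose a reduced expression $w=s_{i_1}\cdots s_{i_k}$ and put $g_w=g_{i_1}\cdots g_{i_k}$ (by Matsumoto's lemma this does not depend on the choice). The cyclotomic Yokonuma–Hecke algebra $Y_{r,n}^d$ over $A$ is the quotient of $\widehat Y_{r,n}$ by the two-sided ideal generated by $(X_1-v_1)\cdots(X_1-v_d)$. Theorem. The canonical images in $Y_{r,n}^d$ of the elements $X^\alpha t^\beta g_w$, with $0\le\alpha_i<d$ and $0\le\beta_i<r$ for $1\le i\le n$ and $w\in\mathfrak S_n$, form an $A$-basis of $Y_{r,n}^d$. In particular $Y_{r,n}^d$ is a free $A$-module of rank $(rd)^n\,n!$. -/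

import Mathlib

namespace YokonumaHecke

/-- The generators `t_1, …, t_n`, `g_1, …, g_{n-1}`, `X_1`, `X_1⁻¹`. Indices are shifted to start
at `0`: `t i` is `t_{i+1}` and `g i` is `g_{i+1}`. -/
inductive Gen (n : ℕ) : Type
  | t (i : Fin n) : Gen n
  | g (i : Fin (n - 1)) : Gen n
  | X : Gen n
  | Xinv : Gen n

/-- The ring `ℤ[1/r, ζ]` with `ζ = exp (2πi/r)`, as a subring of `ℂ`. -/
abbrev CycInt (r : ℕ) : Type :=
  Algebra.adjoin ℤ
    ({(r : ℂ)⁻¹, Complex.exp (2 * (Real.pi : ℂ) * Complex.I / (r : ℂ))} : Set ℂ)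

/-- The ring `R = ℤ[1/r][q, q⁻¹, ζ]`, with `q` an indeterminate: Laurent polynomials in `q` over
`ℤ[1/r, ζ]`. -/
abbrev BaseRing (r : ℕ) : Type := LaurentPolynomial (CycInt r)

/-- The element `1/r` of `R`. -/
noncomputable def rInv (r : ℕ) : BaseRing r :=
  LaurentPolynomial.C ⟨(r : ℂ)⁻¹, Algebra.subset_adjoin (Set.mem_insert _ _)⟩

/-- The element `q - q⁻¹` of `R`. -/
noncomputable def qSub (r : ℕ) : BaseRing r :=
  LaurentPolynomial.T 1 - LaurentPolynomial.T (-1)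

/-- For `i < n - 1`, the index `i` as an element of `Fin n`. -/
def left {n : ℕ} (i : Fin (n - 1)) : Fin n := ⟨i, by omega⟩

/-- For `i < n - 1`, the index `i + 1` as an element of `Fin n`. -/
def right {n : ℕ} (i : Fin (n - 1)) : Fin n := ⟨i + 1, by omega⟩

/-- The simple transposition exchanging `i` and `i + 1`. -/
def simple {n : ℕ} (i : Fin (n - 1)) : Equiv.Perm (Fin n) := Equiv.swap (left i) (right i)

section Affine

variable (r n : ℕ) (A : Type*) [CommRing A] [Algebra (BaseRing r) A]

/-- The generator `t_i` in the free algebra. -/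
abbrev freeT (i : Fin n) : FreeAlgebra A (Gen n) := FreeAlgebra.ι A (Gen.t i)

/-- The generator `g_i` in the free algebra. -/
abbrev freeG (i : Fin (n - 1)) : FreeAlgebra A (Gen n) := FreeAlgebra.ι A (Gen.g i)

/-- The generator `X_1` in the free algebra. -/
abbrev freeX : FreeAlgebra A (Gen n) := FreeAlgebra.ι A Gen.X

/-- The generator `X_1⁻¹` in the free algebra. -/
abbrev freeXinv : FreeAlgebra A (Gen n) := FreeAlgebra.ι A Gen.Xinv

/-- The word for `e_i = (1/r) ∑_{s=0}^{r-1} t_i^s t_{i+1}^{-s}`. Because of the relation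
`t_{i+1}^r = 1`, the power `t_{i+1}^{-s}` is written `t_{i+1}^{r-s}`, where `s < r`. -/
noncomputable def freeE (i : Fin (n - 1)) : FreeAlgebra A (Gen n) :=
  algebraMap (BaseRing r) A (rInv r) •
    ∑ s ∈ Finset.range r, freeT n A (left i) ^ s * freeT n A (right i) ^ (r - s)

/-- The defining relations of the affine Yokonuma-Hecke algebra. -/
inductive AffineRel : FreeAlgebra A (Gen n) → FreeAlgebra A (Gen n) → Prop
  | g_comm (i j : Fin (n - 1)) (h : (i : ℕ) + 2 ≤ j ∨ (j : ℕ) + 2 ≤ i) :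
      AffineRel (freeG n A i * freeG n A j) (freeG n A j * freeG n A i)
  | g_braid (i j : Fin (n - 1)) (h : (j : ℕ) = i + 1) :
      AffineRel (freeG n A i * freeG n A j * freeG n A i)
        (freeG n A j * freeG n A i * freeG n A j)
  | t_comm (i j : Fin n) :
      AffineRel (freeT n A i * freeT n A j) (freeT n A j * freeT n A i)
  | g_t (i : Fin (n - 1)) (j : Fin n) :
      AffineRel (freeG n A i * freeT n A j) (freeT n A (simple i j) * freeG n A i)
  | t_pow (i : Fin n) : AffineRel (freeT n A i ^ r) 1
  | g_sq (i : Fin (n - 1)) :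
      AffineRel (freeG n A i ^ 2)
        (1 + algebraMap (BaseRing r) A (qSub r) • (freeE r n A i * freeG n A i))
  | X_Xinv : AffineRel (freeX n A * freeXinv n A) 1
  | Xinv_X : AffineRel (freeXinv n A * freeX n A) 1
  | g_X_g_X (i : Fin (n - 1)) (h : (i : ℕ) = 0) :
      AffineRel (freeG n A i * freeX n A * freeG n A i * freeX n A)
        (freeX n A * freeG n A i * freeX n A * freeG n A i)
  | g_X (i : Fin (n - 1)) (h : (i : ℕ) ≠ 0) :
      AffineRel (freeG n A i * freeX n A) (freeX n A * freeG n A i)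
  | t_X (j : Fin n) : AffineRel (freeT n A j * freeX n A) (freeX n A * freeT n A j)

/-- The affine Yokonuma-Hecke algebra, over a commutative `R`-algebra `A`. -/
abbrev Affine : Type _ := RingQuot (AffineRel r n A)

/-- The image of a generator in the affine Yokonuma-Hecke algebra. -/
noncomputable def gen (x : Gen n) : Affine r n A :=
  RingQuot.mkAlgHom A (AffineRel r n A) (FreeAlgebra.ι A x)

/-- The elements `X_1, …, X_n` (indexed from `0`), given by `X_{i+1} = g_i X_i g_i`. -/
noncomputable def xElem : (i : ℕ) → i < n → Affine r n A
  | 0, _ => gen r n A Gen.X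
  | i + 1, h =>
      gen r n A (Gen.g ⟨i, by omega⟩) * xElem i (by omega) * gen r n A (Gen.g ⟨i, by omega⟩)

/-- `X^α = X_1^{α_1} ⋯ X_n^{α_n}`. -/
noncomputable def xMonomial (α : Fin n → ℕ) : Affine r n A :=
  (List.ofFn fun i : Fin n => xElem r n A i i.isLt ^ α i).prod

/-- `t^β = t_1^{β_1} ⋯ t_n^{β_n}`. -/
noncomputable def tMonomial (β : Fin n → ℕ) : Affine r n A :=
  (List.ofFn fun i : Fin n => gen r n A (Gen.t i) ^ β i).prod

/-- `g_{i_1} ⋯ g_{i_k}` for a word `i_1, …, i_k`. -/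
noncomputable def gWord (l : List (Fin (n - 1))) : Affine r n A :=
  (l.map fun i => gen r n A (Gen.g i)).prod

/-- `f_1 = (X_1 - v_1) ⋯ (X_1 - v_d)`. -/
noncomputable def fOne {d : ℕ} (v : Fin d → Aˣ) : Affine r n A :=
  (List.ofFn fun i : Fin d =>
    gen r n A Gen.X - algebraMap A (Affine r n A) (v i : A)).prod

/-- The cyclotomic Yokonuma-Hecke algebra: the quotient of the affine one by the two-sided ideal
generated by `f_1`. -/
abbrev Cyclotomic {d : ℕ} (v : Fin d → Aˣ) : Type _ :=
  (TwoSidedIdeal.span {fOne r n A v}).ringCon.Quotient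

/-- The canonical map from the affine to the cyclotomic Yokonuma-Hecke algebra. -/
noncomputable def toCyclotomic {d : ℕ} (v : Fin d → Aˣ) :
    Affine r n A →+* Cyclotomic r n A v :=
  (TwoSidedIdeal.span {fOne r n A v}).ringCon.mk'

end Affine

/-- `l = (i_1, …, i_k)` is a reduced expression of `w`: `w = s_{i_1} ⋯ s_{i_k}`, and no shorter
word in the simple transpositions has product `w`. Products of permutations are compositions of
maps acting on the left; the convention of right actions replaces `w` by `w⁻¹` here, which permutes
the family `(g_w)` and leaves the set of its members unchanged. -/
def IsReducedWord {n : ℕ} (w : Equiv.Perm (Fin n)) (l : List (Fin (n - 1))) : Prop :=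
  (l.map simple).prod = w ∧
    ∀ l' : List (Fin (n - 1)), (l'.map simple).prod = w → l.length ≤ l'.length

/-- Every permutation has a reduced expression. -/
theorem exists_isReducedWord {n : ℕ} (w : Equiv.Perm (Fin n)) :
    ∃ l : List (Fin (n - 1)), IsReducedWord w l := by
  have key : ∃ l : List (Fin (n - 1)), (l.map simple).prod = w := by
    cases n with
    | zero => exact ⟨[], Subsingleton.elim _ _⟩
    | succ m =>
      have hw : w ∈ Submonoid.closure
          (Set.range fun i : Fin m => Equiv.swap i.castSucc i.succ) := by
        rw [Equiv.Perm.mclosure_swap_castSucc_succ]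
        trivial
      induction hw using Submonoid.closure_induction with
      | mem x hx =>
        obtain ⟨i, rfl⟩ := hx
        refine ⟨[(i : Fin (m + 1 - 1))], ?_⟩
        rw [List.map_singleton, List.prod_singleton]
        rfl
      | one => exact ⟨[], rfl⟩
      | mul x y _ _ hx hy =>
        obtain ⟨a, ha⟩ := hx
        obtain ⟨b, hb⟩ := hy
        exact ⟨a ++ b, by rw [List.map_append, List.prod_append, ha, hb]⟩
  classical
  have hk : ∃ k : ℕ, ∃ l : List (Fin (n - 1)), (l.map simple).prod = w ∧ l.length = k := by
    obtain ⟨l, hl⟩ := key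
    exact ⟨l.length, l, hl, rfl⟩
  obtain ⟨l, hl, hlen⟩ := Nat.find_spec hk
  refine ⟨l, hl, fun l' hl' => ?_⟩
  rw [hlen]
  exact Nat.find_min' hk ⟨l', hl', rfl⟩

end YokonumaHecke

/-!
The elements `X^α t^β g_w` span because their span `V` contains `1` and is stable under *left*
multiplication by the generators. Moving `g_i` through a monomial `X^α` never raises the largest
of the exponents `α_i`, `α_{i+1}` (`Relations.g_mul_pow_mul_pow`); multiplying by `X_1` raises
only `α_1`, and `X_1^d` is reduced by the polynomial relation; and `g_i g_w` is `g_{s_i w}`, up to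
a multiple of `e_i g_w`, by Matsumoto's lemma (`prod_eq_of_isReducedWord`). No reduction of `X_i^d`
with `i > 1` is ever needed. This is `span_monomials_eq_top`.

Linear independence comes from a representation on tensor space, following Sakamoto and Shoji.
Letters carry an eigenvalue of `t`, an eigenvalue of `X` and a colour. The `g_i` act by an R-matrix
`T_i` in which letters with the same `t`-value interact; `S_i` is the R-matrix in which
only letters with the same `t`-value and the same `X`-value interact; and `X_1` acts as
`T_1⁻¹ ⋯ T_{n-1}⁻¹ ω_n S_{n-1} ⋯ S_1`, where `ω_n` multiplies by the `X`-value of the last letter.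
Since `T_i - S_i` is a multiplication operator, the mixed braid relations between `T` and `S`
follow from the braid relation of `S`, and they give the relations of `X_1` by an induction from
the last position down (`BraidPair`). The operator `X_1` is triangular with eigenvalues `v_i`, so
`(X_1 - v_1) ⋯ (X_1 - v_d)` acts by zero (`ofFn_sub_prod_eq_zero`).

This representation need not be faithful when some `v_i` coincide, so it is used only over the
universal ring, where the `v_i` are indeterminates. That ring is a domain, and a square matrix of
coefficients of the operators `X^α t^β g_w` has nonzero determinant since at `q = 1` the
operators `g_i` become permutations of the positions and the matrix becomes block diagonal, with
tensor products of Vandermonde matrices as blocks (`linearIndependent_tensor`).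
Hence the elements form a basis over the universal ring. For a general `A` one maps `Y_{r,n}^d` over `A` to the base change of the
universal algebra, where their images are a basis (`linearIndependent_of_baseChange`).
-/

namespace YokonumaHecke

/-! ### Reduced words in the symmetric group -/

section Words

variable {n : ℕ}

theorem left_lt_right (i : Fin (n - 1)) : left i < right i := by
  simp [left, right, Fin.lt_def]

theorem simple_mul_self (i : Fin (n - 1)) : simple i * simple i = 1 :=
  Equiv.swap_mul_self _ _

theorem simple_apply_simple (i : Fin (n - 1)) (a : Fin n) : simple i (simple i a) = a :=
  Equiv.swap_apply_self _ _ _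

theorem simple_left (i : Fin (n - 1)) : simple i (left i) = right i :=
  Equiv.swap_apply_left _ _

theorem simple_right (i : Fin (n - 1)) : simple i (right i) = left i :=
  Equiv.swap_apply_right _ _

theorem simple_of_ne (i : Fin (n - 1)) {a : Fin n} (h₁ : a ≠ left i) (h₂ : a ≠ right i) :
    simple i a = a :=
  Equiv.swap_apply_of_ne_of_ne h₁ h₂

theorem simple_val (i : Fin (n - 1)) (a : Fin n) :
    ((simple i a : Fin n) : ℕ) = if (a : ℕ) = i then (i : ℕ) + 1 else
      if (a : ℕ) = i + 1 then (i : ℕ) else a := by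
  simp only [simple, Equiv.swap_apply_def, left, right, Fin.ext_iff]
  split_ifs <;> simp_all

/-- The inversions of `w⁻¹`; with this convention `simple i * w` is easy to compare with `w`. -/
def inversions (w : Equiv.Perm (Fin n)) : Finset (Fin n × Fin n) :=
  Finset.univ.filter fun p => p.1 < p.2 ∧ w⁻¹ p.2 < w⁻¹ p.1

/-- The number of inversions of `w⁻¹`, which is the Coxeter length of `w`. -/
def inversionNumber (w : Equiv.Perm (Fin n)) : ℕ := (inversions w).card

theorem simple_lt_simple (i : Fin (n - 1)) {a b : Fin n} (h₁ : ¬ (a = left i ∧ b = right i))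
    (h₂ : ¬ (a = right i ∧ b = left i)) : simple i a < simple i b ↔ a < b := by
  simp only [Fin.lt_def, simple_val, left, right, Fin.ext_iff] at *
  split_ifs <;> omega

theorem simple_mul_inv_apply (i : Fin (n - 1)) (w : Equiv.Perm (Fin n)) (a : Fin n) :
    (simple i * w)⁻¹ a = w⁻¹ (simple i a) := by
  rw [mul_inv_rev, Equiv.Perm.mul_apply, simple, Equiv.swap_inv]

theorem inversionNumber_simple_mul_of_lt (i : Fin (n - 1)) (w : Equiv.Perm (Fin n))
    (h : w⁻¹ (left i) < w⁻¹ (right i)) :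
    inversionNumber (simple i * w) = inversionNumber w + 1 := by
  have hset : inversions (simple i * w) = insert (left i, right i)
      ((inversions w).map ((simple i).prodCongr (simple i)).toEmbedding) := by
    ext ⟨a, b⟩
    simp only [inversions, Finset.mem_filter, Finset.mem_univ, true_and, simple_mul_inv_apply,
      Finset.mem_insert, Prod.mk.injEq, Finset.mem_map, Equiv.coe_toEmbedding, Prod.exists,
      Equiv.prodCongr_apply, Prod.map_apply]
    constructor
    · rintro ⟨hab, hw⟩
      by_cases h1 : a = left i ∧ b = right i
      · exact Or.inl h1
      · refine Or.inr ⟨simple i a, simple i b, ⟨?_, hw⟩, simple_apply_simple i a,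
          simple_apply_simple i b⟩
        refine (simple_lt_simple i h1 ?_).2 hab
        rintro ⟨rfl, rfl⟩
        exact absurd hab (left_lt_right i).not_gt
    · rintro (⟨rfl, rfl⟩ | ⟨a', b', ⟨hab, hw⟩, rfl, rfl⟩)
      · simpa [simple_left, simple_right] using ⟨left_lt_right i, h⟩
      · rw [simple_apply_simple, simple_apply_simple]
        refine ⟨(simple_lt_simple i ?_ ?_).2 hab, hw⟩
        · rintro ⟨rfl, rfl⟩
          exact absurd hw h.not_gt
        · rintro ⟨rfl, rfl⟩
          exact absurd hab (left_lt_right i).not_gt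
  have hnot : (left i, right i) ∉
      (inversions w).map ((simple i).prodCongr (simple i)).toEmbedding := by
    simp only [inversions, Finset.mem_map, Finset.mem_filter, Finset.mem_univ, true_and,
      Equiv.coe_toEmbedding, Prod.exists, Equiv.prodCongr_apply, Prod.map_apply, Prod.mk.injEq]
    rintro ⟨a, b, ⟨hab, -⟩, ha, hb⟩
    have ha' : a = right i := by rw [← simple_left, ← ha, simple_apply_simple]
    have hb' : b = left i := by rw [← simple_right, ← hb, simple_apply_simple]
    subst ha' hb'
    exact absurd hab (left_lt_right i).not_gt
  rw [inversionNumber, hset, Finset.card_insert_of_notMem hnot, Finset.card_map, inversionNumber]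

theorem simple_mul_simple_mul (i : Fin (n - 1)) (w : Equiv.Perm (Fin n)) :
    simple i * (simple i * w) = w := by
  rw [← mul_assoc, simple_mul_self, one_mul]

theorem inversionNumber_simple_mul_of_gt (i : Fin (n - 1)) (w : Equiv.Perm (Fin n))
    (h : w⁻¹ (right i) < w⁻¹ (left i)) :
    inversionNumber (simple i * w) + 1 = inversionNumber w := by
  have := inversionNumber_simple_mul_of_lt i (simple i * w)
    (by rwa [simple_mul_inv_apply, simple_mul_inv_apply, simple_left, simple_right])
  rw [simple_mul_simple_mul] at this
  exact this.symm

theorem inv_left_lt_or (i : Fin (n - 1)) (w : Equiv.Perm (Fin n)) :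
    w⁻¹ (left i) < w⁻¹ (right i) ∨ w⁻¹ (right i) < w⁻¹ (left i) :=
  lt_or_gt_of_ne fun h => (left_lt_right i).ne (w⁻¹.injective h)

theorem inversionNumber_simple_mul_le (i : Fin (n - 1)) (w : Equiv.Perm (Fin n)) :
    inversionNumber (simple i * w) ≤ inversionNumber w + 1 := by
  rcases inv_left_lt_or i w with h | h
  · exact (inversionNumber_simple_mul_of_lt i w h).le
  · have := inversionNumber_simple_mul_of_gt i w h
    omega

theorem inversionNumber_one : inversionNumber (1 : Equiv.Perm (Fin n)) = 0 := by
  rw [inversionNumber, inversions, Finset.card_eq_zero, Finset.filter_eq_empty_iff]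
  rintro p - ⟨h₁, h₂⟩
  exact absurd h₁ (by simpa using h₂.not_gt)

theorem inversionNumber_prod_le (l : List (Fin (n - 1))) :
    inversionNumber (l.map simple).prod ≤ l.length := by
  induction l with
  | nil => simp [inversionNumber_one]
  | cons i l ih =>
    rw [List.map_cons, List.prod_cons, List.length_cons]
    exact (inversionNumber_simple_mul_le i _).trans (by omega)

theorem eq_one_of_forall_inv_lt (w : Equiv.Perm (Fin n))
    (h : ∀ i : Fin (n - 1), w⁻¹ (left i) < w⁻¹ (right i)) : w = 1 := by
  cases n with
  | zero => exact Subsingleton.elim _ _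
  | succ m =>
    have hmono : StrictMono (w⁻¹ : Equiv.Perm (Fin (m + 1))) :=
      Fin.strictMono_iff_lt_succ.2 fun i => h i
    have hiso : hmono.orderIsoOfSurjective _ (w⁻¹).surjective = OrderIso.refl _ :=
      Subsingleton.elim _ _
    rw [← inv_eq_one]
    ext a : 1
    exact DFunLike.congr_fun hiso a

theorem exists_word_length_eq (k : ℕ) : ∀ w : Equiv.Perm (Fin n), inversionNumber w = k →
    ∃ l : List (Fin (n - 1)), (l.map simple).prod = w ∧ l.length = k := by
  induction k with
  | zero =>
    intro w hw
    refine ⟨[], ?_, rfl⟩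
    rw [eq_one_of_forall_inv_lt w fun i => ?_]
    · rfl
    · refine (inv_left_lt_or i w).resolve_right fun h => ?_
      have := inversionNumber_simple_mul_of_gt i w h
      omega
  | succ k ih =>
    intro w hw
    obtain ⟨i, hi⟩ : ∃ i : Fin (n - 1), w⁻¹ (right i) < w⁻¹ (left i) := by
      by_contra hcon
      push Not at hcon
      rw [eq_one_of_forall_inv_lt w fun i => (inv_left_lt_or i w).resolve_right (hcon i).not_gt,
        inversionNumber_one] at hw
      omega
    obtain ⟨l, hl, hlen⟩ := ih (simple i * w) (by
      have := inversionNumber_simple_mul_of_gt i w hi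
      omega)
    exact ⟨i :: l, by rw [List.map_cons, List.prod_cons, hl, simple_mul_simple_mul],
      by rw [List.length_cons, hlen]⟩

theorem isReducedWord_iff {w : Equiv.Perm (Fin n)} {l : List (Fin (n - 1))} :
    IsReducedWord w l ↔ (l.map simple).prod = w ∧ l.length = inversionNumber w := by
  constructor
  · rintro ⟨h, hmin⟩
    obtain ⟨l', hl', hlen⟩ := exists_word_length_eq _ w rfl
    exact ⟨h, le_antisymm (hlen ▸ hmin l' hl') (h ▸ inversionNumber_prod_le l)⟩
  · rintro ⟨h, hlen⟩
    exact ⟨h, fun l' hl' => hlen ▸ hl' ▸ inversionNumber_prod_le l'⟩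

theorem IsReducedWord.of_cons {w : Equiv.Perm (Fin n)} {i : Fin (n - 1)} {l : List (Fin (n - 1))}
    (h : IsReducedWord w (i :: l)) :
    IsReducedWord (simple i * w) l ∧ w⁻¹ (right i) < w⁻¹ (left i) := by
  rw [isReducedWord_iff, List.map_cons, List.prod_cons, List.length_cons] at h
  obtain ⟨h₁, h₂⟩ := h
  have hl : (l.map simple).prod = simple i * w := by rw [← h₁, simple_mul_simple_mul]
  have hle := inversionNumber_prod_le l
  rw [hl] at hle
  rcases inv_left_lt_or i w with h | h
  · have := inversionNumber_simple_mul_of_lt i w h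
    omega
  · have := inversionNumber_simple_mul_of_gt i w h
    exact ⟨isReducedWord_iff.2 ⟨hl, by omega⟩, h⟩

theorem IsReducedWord.cons_of_gt {w : Equiv.Perm (Fin n)} {i : Fin (n - 1)}
    {l : List (Fin (n - 1))} (h : IsReducedWord (simple i * w) l)
    (hi : w⁻¹ (right i) < w⁻¹ (left i)) : IsReducedWord w (i :: l) := by
  rw [isReducedWord_iff] at h ⊢
  rw [List.map_cons, List.prod_cons, List.length_cons, h.1, simple_mul_simple_mul, h.2]
  exact ⟨rfl, inversionNumber_simple_mul_of_gt i w hi⟩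

theorem IsReducedWord.cons_of_lt {w : Equiv.Perm (Fin n)} {i : Fin (n - 1)}
    {l : List (Fin (n - 1))} (h : IsReducedWord w l)
    (hi : w⁻¹ (left i) < w⁻¹ (right i)) : IsReducedWord (simple i * w) (i :: l) := by
  refine IsReducedWord.cons_of_gt (by rwa [simple_mul_simple_mul]) ?_
  rwa [simple_mul_inv_apply, simple_mul_inv_apply, simple_left, simple_right]

theorem simple_comm {i j : Fin (n - 1)} (h : (i : ℕ) + 2 ≤ j ∨ (j : ℕ) + 2 ≤ i) :
    simple i * simple j = simple j * simple i := by
  ext a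
  simp only [Equiv.Perm.mul_apply, simple_val]
  split_ifs <;> omega

theorem simple_braid {i j : Fin (n - 1)} (h : (j : ℕ) = i + 1) :
    simple i * simple j * simple i = simple j * simple i * simple j := by
  have hji : left j = right i := by simp [left, right, h]
  have h₁ : left i ≠ right i := (left_lt_right i).ne
  have h₂ : right i ≠ right j := hji ▸ (left_lt_right j).ne
  have h₃ : left i ≠ right j := ((left_lt_right i).trans (hji ▸ left_lt_right j)).ne
  have e₁ := Equiv.swap_mul_swap_mul_swap h₂.symm h₃.symm
  have e₂ := Equiv.swap_mul_swap_mul_swap h₁ h₃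
  rw [Equiv.swap_comm (right i) (left i), Equiv.swap_comm (right j) (right i)] at e₁
  rw [simple, simple, hji, e₁, e₂, Equiv.swap_comm]

/-- **Matsumoto's lemma** for the symmetric group: if the elements `g i` of a monoid satisfy the
braid relations, then all reduced expressions of a permutation give the same product. -/
theorem prod_eq_of_isReducedWord {M : Type*} [Monoid M] (g : Fin (n - 1) → M)
    (hcomm : ∀ i j : Fin (n - 1), (i : ℕ) + 2 ≤ j ∨ (j : ℕ) + 2 ≤ i → g i * g j = g j * g i)
    (hbraid : ∀ i j : Fin (n - 1), (j : ℕ) = i + 1 → g i * g j * g i = g j * g i * g j)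
    (l : List (Fin (n - 1))) : ∀ (l' : List (Fin (n - 1))) (w : Equiv.Perm (Fin n)),
      IsReducedWord w l → IsReducedWord w l' → (l.map g).prod = (l'.map g).prod := by
  induction hk : l.length using Nat.strong_induction_on generalizing l with
  | _ k ih =>
  intro l' w hl hl'
  have hlen : l'.length = l.length :=
    (isReducedWord_iff.1 hl').2.trans (isReducedWord_iff.1 hl).2.symm
  match l, l' with
  | [], [] => rfl
  | [], _ :: _ => simp at hlen
  | _ :: _, [] => simp at hlen
  | i :: l, j :: l' =>
    obtain ⟨hl₁, hi⟩ := hl.of_cons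
    obtain ⟨hl₁', hj⟩ := hl'.of_cons
    simp only [List.length_cons] at hk hlen
    simp only [List.map_cons, List.prod_cons]
    -- the case of neighbouring first letters, up to exchanging the two words
    have key : ∀ (i j : Fin (n - 1)) (l l' : List (Fin (n - 1))), l.length + 1 = k →
        l'.length = l.length → IsReducedWord (simple i * w) l → w⁻¹ (right i) < w⁻¹ (left i) →
        IsReducedWord (simple j * w) l' → w⁻¹ (right j) < w⁻¹ (left j) → (j : ℕ) = i + 1 →
        g i * (l.map g).prod = g j * (l'.map g).prod := by
      intro i j l l' hk hlen hl₁ hi hl₁' hj hij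
      have hji : left j = right i := by simp [left, right, hij]
      have hri : simple i (right j) = right j := simple_of_ne i
        (by simp [left, right]; omega) (by simp [right, Fin.ext_iff]; omega)
      have hlj : simple j (left i) = left i := simple_of_ne j
        (by simp [left, Fin.ext_iff]; omega) (by simp [left, right, Fin.ext_iff]; omega)
      obtain ⟨m, hm⟩ := exists_isReducedWord (simple i * (simple j * (simple i * w)))
      have hm' : IsReducedWord (simple j * (simple i * (simple j * w))) m := by
        have := simple_braid hij
        simp only [mul_assoc] at this
        have h2 := congrArg (· * w) this
        simp only [mul_assoc] at h2
        rwa [← h2]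
      have e₁ : IsReducedWord (simple i * w) (j :: i :: m) := by
        refine IsReducedWord.cons_of_gt (IsReducedWord.cons_of_gt hm ?_) ?_
        · rw [simple_mul_inv_apply, simple_mul_inv_apply, simple_mul_inv_apply,
            simple_mul_inv_apply, hlj, ← hji, simple_left, simple_left, hri]
          rwa [← hji] at *
        · rw [simple_mul_inv_apply, simple_mul_inv_apply, hri, hji, simple_right]
          exact (hji ▸ hj).trans hi
      have e₂ : IsReducedWord (simple j * w) (i :: j :: m) := by
        refine IsReducedWord.cons_of_gt (IsReducedWord.cons_of_gt hm' ?_) ?_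
        · rw [simple_mul_inv_apply, simple_mul_inv_apply, simple_mul_inv_apply,
            simple_mul_inv_apply, hri, simple_right, hji, simple_right, hlj]
          exact hi
        · rw [simple_mul_inv_apply, simple_mul_inv_apply, hlj, ← hji, simple_left]
          exact hj.trans (hji ▸ hi)
      rw [ih l.length (by omega) l rfl _ _ hl₁ e₁, ih l'.length (by omega) l' rfl _ _ hl₁' e₂]
      simp only [List.map_cons, List.prod_cons]
      rw [← mul_assoc, ← mul_assoc, ← mul_assoc, ← mul_assoc, hbraid i j hij]
    by_cases hij : i = j
    · subst hij
      rw [ih l.length (by omega) l rfl _ _ hl₁ hl₁']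
    by_cases h₁ : (j : ℕ) = i + 1
    · exact key i j l l' hk (by omega) hl₁ hi hl₁' hj h₁
    by_cases h₂ : (i : ℕ) = j + 1
    · exact (key j i l' l (by omega) (by omega) hl₁' hj hl₁ hi h₂).symm
    have hfar : (i : ℕ) + 2 ≤ j ∨ (j : ℕ) + 2 ≤ i := by
      have := Fin.val_ne_of_ne hij
      omega
    have hne : left j ≠ left i ∧ left j ≠ right i ∧ right j ≠ left i ∧ right j ≠ right i := by
      simp only [left, right, ne_eq, Fin.mk.injEq]
      omega
    have eil := simple_of_ne i hne.1 hne.2.1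
    have eir := simple_of_ne i hne.2.2.1 hne.2.2.2
    have ejl := simple_of_ne j hne.1.symm hne.2.2.1.symm
    have ejr := simple_of_ne j hne.2.1.symm hne.2.2.2.symm
    obtain ⟨m, hm⟩ := exists_isReducedWord (simple j * (simple i * w))
    have hm' : IsReducedWord (simple i * (simple j * w)) m := by
      rwa [← mul_assoc, simple_comm hfar, mul_assoc]
    have e₁ : IsReducedWord (simple i * w) (j :: m) := hm.cons_of_gt (by
      rwa [simple_mul_inv_apply, simple_mul_inv_apply, eil, eir])
    have e₂ : IsReducedWord (simple j * w) (i :: m) := hm'.cons_of_gt (by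
      rwa [simple_mul_inv_apply, simple_mul_inv_apply, ejl, ejr])
    rw [ih l.length (by omega) l rfl _ _ hl₁ e₁, ih l'.length (by omega) l' rfl _ _ hl₁' e₂,
      List.map_cons, List.prod_cons, List.map_cons, List.prod_cons, ← mul_assoc, ← mul_assoc,
      hcomm i j hfar]

end Words

/-! ### The defining relations in an arbitrary algebra -/

/-- The idempotent `e_i = (1/r) ∑ t_i^s t_{i+1}^{-s}` formed from elements `t` of an algebra;
`ri` stands for `1/r`. -/
def idem {A E : Type*} [CommRing A] [Ring E] [Algebra A E] (r : ℕ) {n : ℕ} (ri : A)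
    (t : Fin n → E) (i : Fin (n - 1)) : E :=
  ri • ∑ s ∈ Finset.range r, t (left i) ^ s * t (right i) ^ (r - s)

/-- The relations of the affine Yokonuma-Hecke algebra for elements `t`, `g`, `X`, `Xi` of an
`A`-algebra; the scalars `z` and `ri` stand for `q - q⁻¹` and `1/r`. -/
structure Relations {A E : Type*} [CommRing A] [Ring E] [Algebra A E] (r : ℕ) {n : ℕ} (z ri : A)
    (t : Fin n → E) (g : Fin (n - 1) → E) (X Xi : E) : Prop where
  g_comm : ∀ i j : Fin (n - 1), (i : ℕ) + 2 ≤ j ∨ (j : ℕ) + 2 ≤ i → g i * g j = g j * g i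
  g_braid : ∀ i j : Fin (n - 1), (j : ℕ) = i + 1 → g i * g j * g i = g j * g i * g j
  t_comm : ∀ i j, t i * t j = t j * t i
  g_t : ∀ i j, g i * t j = t (simple i j) * g i
  t_pow : ∀ i, t i ^ r = 1
  g_sq : ∀ i, g i * g i = 1 + z • (idem r ri t i * g i)
  X_Xi : X * Xi = 1
  Xi_X : Xi * X = 1
  g_X_g_X : ∀ i : Fin (n - 1), (i : ℕ) = 0 → g i * X * g i * X = X * g i * X * g i
  g_X : ∀ i : Fin (n - 1), (i : ℕ) ≠ 0 → g i * X = X * g i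
  t_X : ∀ j, t j * X = X * t j

/-- The elements `X_1, …, X_n` (indexed from `0`) formed from elements `g` and `X = X_1`. -/
def murphy {E : Type*} [Monoid E] {n : ℕ} (g : Fin (n - 1) → E) (X : E) : (i : ℕ) → i < n → E
  | 0, _ => X
  | i + 1, h => g ⟨i, by omega⟩ * murphy g X i (by omega) * g ⟨i, by omega⟩

open scoped IsMulCommutative in
/-- The algebra homomorphism from a polynomial ring given by a commuting family of elements of a
possibly noncommutative algebra. -/
noncomputable def evalComm {A E ι : Type*} [CommRing A] [Ring E] [Algebra A E] (y : ι → E)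
    (hy : ∀ i j, y i * y j = y j * y i) : MvPolynomial ι A →ₐ[A] E :=
  haveI : IsMulCommutative (Algebra.adjoin A (Set.range y)) :=
    Algebra.isMulCommutative_adjoin A (by
      rintro _ ⟨i, rfl⟩ _ ⟨j, rfl⟩
      exact hy i j)
  (Algebra.adjoin A (Set.range y)).val.comp
    (MvPolynomial.aeval fun i => (⟨y i, Algebra.subset_adjoin ⟨i, rfl⟩⟩ :
      Algebra.adjoin A (Set.range y)))

section evalComm

variable {A E ι : Type*} [CommRing A] [Ring E] [Algebra A E] (y : ι → E)
    (hy : ∀ i j, y i * y j = y j * y i)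

open scoped IsMulCommutative in
@[simp]
theorem evalComm_X (i : ι) : evalComm (A := A) y hy (MvPolynomial.X i) = y i := by
  simp [evalComm]

theorem ofFn_prod_eq_evalComm {n : ℕ} (y : Fin n → E) (hy : ∀ i j, y i * y j = y j * y i)
    (α : Fin n → ℕ) : (List.ofFn fun i => y i ^ α i).prod =
      evalComm (A := A) y hy (∏ i, MvPolynomial.X i ^ α i) := by
  rw [← List.prod_ofFn, map_list_prod, List.map_ofFn]
  congr 2
  ext i
  simp

end evalComm

theorem commute_idem {A E : Type*} [CommRing A] [Ring E] [Algebra A E] {r n : ℕ} {ri : A}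
    {t : Fin n → E} {y : E} (hy : ∀ j, Commute (t j) y) (i : Fin (n - 1)) :
    Commute (idem r ri t i) y := by
  refine Commute.smul_left ?_ ri
  exact Commute.sum_left _ _ _ fun s _ => ((hy _).pow_left s).mul_left ((hy _).pow_left _)

namespace Relations

variable {A E : Type*} [CommRing A] [Ring E] [Algebra A E] {r n : ℕ} {z ri : A}
    {t : Fin n → E} {g : Fin (n - 1) → E} {X Xi : E} (h : Relations r z ri t g X Xi)
include h

/-- `e_i` is symmetric in `t_i` and `t_{i+1}`, hence commutes with `g_i`. -/
theorem g_mul_idem (i : Fin (n - 1)) : g i * idem r ri t i = idem r ri t i * g i := by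
  have hg : ∀ (j : Fin n) (k : ℕ), g i * t j ^ k = t (simple i j) ^ k * g i := by
    intro j k
    induction k with
    | zero => simp
    | succ k ih => rw [pow_succ, ← mul_assoc, ih, mul_assoc, h.g_t, ← mul_assoc, ← pow_succ]
  have hc : Commute (t (left i)) (t (right i)) := h.t_comm _ _
  rw [idem, mul_smul_comm, smul_mul_assoc, Finset.mul_sum, Finset.sum_mul]
  have e₁ : ∀ s ∈ Finset.range r, g i * (t (left i) ^ s * t (right i) ^ (r - s)) =
      t (left i) ^ (r - s) * t (right i) ^ s * g i := by
    intro s _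
    rw [← mul_assoc, hg, mul_assoc, hg, ← mul_assoc, simple_left, simple_right,
      (hc.pow_pow (r - s) s).eq]
  rw [Finset.sum_congr rfl e₁, ← Finset.sum_mul, ← Finset.sum_mul]
  congr 2
  have e₂ := Finset.sum_range_reflect (fun s => t (left i) ^ s * t (right i) ^ (r - s)) (r + 1)
  rw [Finset.sum_range_succ, Finset.sum_range_succ] at e₂
  simp only [Nat.add_sub_cancel, Nat.sub_self, pow_zero, mul_one, Nat.sub_zero,
    h.t_pow] at e₂
  rw [← add_right_cancel e₂]
  refine Finset.sum_congr rfl fun s hs => ?_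
  rw [Nat.sub_sub_self (Finset.mem_range.1 hs).le]

/-- `g_j` commutes with `X_i` unless `i` is `j` or `j + 1`. -/
theorem commute_g_murphy (j : Fin (n - 1)) : ∀ (i : ℕ) (hi : i < n), i ≠ j → i ≠ j + 1 →
    Commute (g j) (murphy g X i hi) := by
  have key : ∀ (k i : ℕ) (hi : i < n) (j : Fin (n - 1)), i < k → i ≠ j → i ≠ j + 1 →
      Commute (g j) (murphy g X i hi) := by
    intro k
    induction k with
    | zero => intro i _ _ hk; omega
    | succ k ih =>
      intro i hi j hk h₁ h₂
      match i with
      | 0 => exact h.g_X j (fun hj => h₁ hj.symm)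
      | i + 1 =>
        by_cases hij : i = j + 1
        · subst hij
          have hb : g j * g ⟨j + 1, by omega⟩ * g j = _ := h.g_braid j ⟨j + 1, by omega⟩ rfl
          have hx := ih j (by omega) ⟨j + 1, by omega⟩ (by omega) (by simp) (by simp; omega)
          simp only [murphy]
          set a := g j
          set b := g ⟨j + 1, by omega⟩
          set x := murphy g X j (by omega)
          show a * (b * (a * x * a) * b) = b * (a * x * a) * b * a
          calc a * (b * (a * x * a) * b) = (a * b * a) * x * a * b := by simp only [mul_assoc]
            _ = b * a * (b * x) * a * b := by rw [hb]; simp only [mul_assoc]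
            _ = b * a * x * (b * a * b) := by rw [hx.eq]; simp only [mul_assoc]
            _ = _ := by rw [← hb]; simp only [mul_assoc]
        · have hc : Commute (g j) (g ⟨i, by omega⟩) := h.g_comm _ _ (by simp only; omega)
          exact (hc.mul_right (ih i (by omega) j (by omega) (by omega) (by omega))).mul_right hc
  exact fun i hi => key (i + 1) i hi j (by omega)

theorem commute_t_murphy : ∀ (i : ℕ) (hi : i < n) (j : Fin n),
    Commute (t j) (murphy g X i hi) := by
  intro i
  induction i with
  | zero => exact fun _ j => h.t_X j
  | succ i ih =>
    intro hi j
    have h₁ := h.g_t ⟨i, by omega⟩ (simple ⟨i, by omega⟩ j)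
    have h₂ := h.g_t ⟨i, by omega⟩ j
    rw [simple_apply_simple] at h₁
    have h₃ := ih (by omega) (simple ⟨i, by omega⟩ j)
    simp only [murphy]
    rw [Commute, SemiconjBy, ← mul_assoc, ← mul_assoc, ← h₁, mul_assoc (g _) (t _), h₃.eq]
    simp only [mul_assoc]
    rw [h₂]

theorem commute_murphy_aux (i : ℕ) : ∀ (hi : i < n) (j : ℕ) (hj : j < n), i < j →
    Commute (murphy g X i hi) (murphy g X j hj) := by
  induction i with
  | zero =>
    intro hi j
    induction j with
    | zero => intro _ h; omega
    | succ j ih =>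
      intro hj _
      rcases Nat.eq_zero_or_pos j with rfl | hpos
      · have := h.g_X_g_X ⟨0, by omega⟩ rfl
        simp only [murphy]
        rw [Commute, SemiconjBy, ← mul_assoc, ← mul_assoc, this]
      · have hg : Commute (murphy g X 0 hi) (g ⟨j, by omega⟩) :=
          (h.commute_g_murphy _ 0 hi (by simp; omega) (by simp)).symm
        exact (hg.mul_right (ih (by omega) hpos)).mul_right hg
  | succ i ih =>
    intro hi j hj hij
    have hg := h.commute_g_murphy ⟨i, by omega⟩ j hj (by simp; omega) (by simp; omega)
    exact (hg.mul_left (ih (by omega) j hj (by omega))).mul_left hg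

theorem commute_murphy (i : ℕ) (hi : i < n) (j : ℕ) (hj : j < n) :
    Commute (murphy g X i hi) (murphy g X j hj) := by
  rcases lt_trichotomy i j with hij | rfl | hij
  · exact h.commute_murphy_aux i hi j hj hij
  · rfl
  · exact (h.commute_murphy_aux j hj i hi hij).symm

theorem murphy_mul (i j : Fin n) :
    murphy g X i i.isLt * murphy g X j j.isLt = murphy g X j j.isLt * murphy g X i i.isLt :=
  h.commute_murphy _ _ _ _

theorem commute_idem_murphy (i : Fin (n - 1)) (j : Fin n) :
    Commute (idem r ri t i) (murphy g X j j.isLt) :=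
  commute_idem (fun k => h.commute_t_murphy j j.isLt k) i

theorem g_mul_murphy_right (i : Fin (n - 1)) :
    g i * murphy g X (right i) (right i).isLt = murphy g X (left i) (left i).isLt * g i +
      z • (murphy g X (right i) (right i).isLt * idem r ri t i) := by
  rw [← (h.commute_idem_murphy i (right i)).eq]
  change g i * (g i * murphy g X (left i) (left i).isLt * g i) = _ + z • (_ *
    (g i * murphy g X (left i) (left i).isLt * g i))
  rw [← mul_assoc, ← mul_assoc, h.g_sq, add_mul, one_mul, add_mul]
  simp only [smul_mul_assoc, mul_assoc]

theorem g_mul_murphy_left (i : Fin (n - 1)) :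
    g i * murphy g X (left i) (left i).isLt = murphy g X (right i) (right i).isLt * g i -
      z • (murphy g X (right i) (right i).isLt * idem r ri t i) := by
  change _ = g i * murphy g X (left i) (left i).isLt * g i * g i - z •
    (g i * murphy g X (left i) (left i).isLt * g i * _)
  rw [mul_assoc _ (g i) (g i), mul_assoc _ (g i), h.g_sq, h.g_mul_idem, mul_add, mul_one,
    mul_smul_comm, add_sub_cancel_right]

/-- The exponents of `X_i` on the right stay below `a`, and those of `X_{i+1}` are at most `a`. -/
theorem g_mul_murphy_left_pow (i : Fin (n - 1)) (a : ℕ) :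
    g i * murphy g X (left i) (left i).isLt ^ a = murphy g X (right i) (right i).isLt ^ a * g i -
      z • ((∑ k ∈ Finset.range a, murphy g X (left i) (left i).isLt ^ k *
        murphy g X (right i) (right i).isLt ^ (a - k)) * idem r ri t i) := by
  have hxy := h.murphy_mul (left i) (right i)
  have hx := (h.commute_idem_murphy i (left i)).eq
  have hg := h.g_mul_murphy_left i
  set x := murphy g X (left i) (left i).isLt
  set y := murphy g X (right i) (right i).isLt
  set e := idem r ri t i
  induction a with
  | zero => simp
  | succ a ih =>
    have hD : (∑ k ∈ Finset.range (a + 1), x ^ k * y ^ (a + 1 - k)) =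
        (∑ k ∈ Finset.range a, x ^ k * y ^ (a - k)) * x + y ^ (a + 1) := by
      rw [Finset.sum_range_succ', Finset.sum_mul, pow_zero, one_mul, Nat.sub_zero]
      congr 1
      refine Finset.sum_congr rfl fun k _ => ?_
      rw [Nat.add_sub_add_right, mul_assoc, ((Commute.pow_right hxy (a - k)).eq).symm, pow_succ,
        mul_assoc]
    rw [pow_succ, ← mul_assoc, ih, sub_mul, mul_assoc, hg, hD, smul_mul_assoc, mul_assoc _ e x,
      hx, add_mul, mul_sub, pow_succ, mul_smul_comm, smul_add]
    simp only [mul_assoc]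
    abel

theorem g_mul_murphy_right_pow (i : Fin (n - 1)) (b : ℕ) :
    g i * murphy g X (right i) (right i).isLt ^ b = murphy g X (left i) (left i).isLt ^ b * g i +
      z • ((∑ k ∈ Finset.range b, murphy g X (left i) (left i).isLt ^ k *
        murphy g X (right i) (right i).isLt ^ (b - k)) * idem r ri t i) := by
  have hy := (h.commute_idem_murphy i (right i)).eq
  have hg := h.g_mul_murphy_right i
  set x := murphy g X (left i) (left i).isLt
  set y := murphy g X (right i) (right i).isLt
  set e := idem r ri t i
  induction b with
  | zero => simp
  | succ b ih =>
    have hD : (∑ k ∈ Finset.range (b + 1), x ^ k * y ^ (b + 1 - k)) =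
        (∑ k ∈ Finset.range b, x ^ k * y ^ (b - k)) * y + x ^ b * y := by
      rw [Finset.sum_range_succ, Finset.sum_mul, Nat.add_sub_cancel_left, pow_one]
      congr 1
      refine Finset.sum_congr rfl fun k hk => ?_
      rw [Nat.sub_add_comm (Finset.mem_range.1 hk).le, pow_succ, mul_assoc]
    rw [pow_succ, ← mul_assoc, ih, add_mul, mul_assoc, hg, hD, smul_mul_assoc, mul_assoc _ e y,
      hy, add_mul, mul_add, pow_succ, mul_smul_comm, smul_add]
    simp only [mul_assoc]
    abel

theorem g_mul_left_mul_right (i : Fin (n - 1)) :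
    Commute (g i) (murphy g X (left i) (left i).isLt * murphy g X (right i) (right i).isLt) := by
  have hxy := h.murphy_mul (left i) (right i)
  have hy := (h.commute_idem_murphy i (right i)).eq
  have hg := h.g_mul_murphy_left i
  have hg' := h.g_mul_murphy_right i
  set x := murphy g X (left i) (left i).isLt
  set y := murphy g X (right i) (right i).isLt
  set e := idem r ri t i
  rw [Commute, SemiconjBy, ← mul_assoc, hg, sub_mul, mul_assoc, hg', mul_add, smul_mul_assoc,
    mul_assoc y e y, hy, mul_smul_comm, add_sub_cancel_right, ← mul_assoc, hxy]

/-- Moving `g_i` through `X_i^a X_{i+1}^b` produces only monomials with exponents at most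
`max a b`, so that the bound `α_i < d` on exponents is respected. -/
theorem g_mul_pow_mul_pow (i : Fin (n - 1)) (a b : ℕ) :
    ∃ u ∈ Submodule.span A {y : E | ∃ k l : ℕ, k ≤ max a b ∧ l ≤ max a b ∧
        y = murphy g X (left i) (left i).isLt ^ k * murphy g X (right i) (right i).isLt ^ l},
      g i * (murphy g X (left i) (left i).isLt ^ a * murphy g X (right i) (right i).isLt ^ b) =
        murphy g X (left i) (left i).isLt ^ b * murphy g X (right i) (right i).isLt ^ a * g i +
          u * idem r ri t i := by
  have hxy : Commute (murphy g X (left i) (left i).isLt) (murphy g X (right i) (right i).isLt) :=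
    h.murphy_mul (left i) (right i)
  have hc := h.g_mul_left_mul_right i
  have hl := h.g_mul_murphy_left_pow i
  have hr := h.g_mul_murphy_right_pow i
  set x := murphy g X (left i) (left i).isLt
  set y := murphy g X (right i) (right i).isLt
  set e := idem r ri t i
  have hD : ∀ c m : ℕ, (x * y) ^ c * (∑ k ∈ Finset.range m, x ^ k * y ^ (m - k)) ∈
      Submodule.span A {w : E | ∃ k l : ℕ, k ≤ c + m ∧ l ≤ c + m ∧ w = x ^ k * y ^ l} := by
    intro c m
    rw [Finset.mul_sum]
    refine Submodule.sum_mem _ fun k hk => Submodule.subset_span ⟨c + k, c + (m - k), ?_, ?_, ?_⟩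
    · have := Finset.mem_range.1 hk
      omega
    · omega
    · rw [hxy.mul_pow, mul_assoc, ← mul_assoc (y ^ c), ((hxy.pow_pow k c).eq).symm, pow_add,
        pow_add]
      simp only [mul_assoc]
  rcases le_total a b with hab | hab
  · obtain ⟨m, rfl⟩ := Nat.exists_eq_add_of_le hab
    refine ⟨z • ((x * y) ^ a * ∑ k ∈ Finset.range m, x ^ k * y ^ (m - k)), ?_, ?_⟩
    · rw [max_eq_right hab]
      exact Submodule.smul_mem _ _ (hD a m)
    · have e₁ : x ^ a * y ^ (a + m) = (x * y) ^ a * y ^ m := by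
        rw [hxy.mul_pow, pow_add, mul_assoc]
      have e₂ : x ^ (a + m) * y ^ a = (x * y) ^ a * x ^ m := by
        rw [hxy.mul_pow, pow_add, mul_assoc, mul_assoc, (hxy.pow_pow m a).eq]
      rw [e₁, e₂, ← mul_assoc, (hc.pow_right a).eq, mul_assoc, hr, mul_add, mul_smul_comm,
        smul_mul_assoc]
      simp only [mul_assoc]
  · obtain ⟨m, rfl⟩ := Nat.exists_eq_add_of_le hab
    refine ⟨-(z • ((x * y) ^ b * ∑ k ∈ Finset.range m, x ^ k * y ^ (m - k))), ?_, ?_⟩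
    · rw [max_eq_left hab]
      exact Submodule.neg_mem _ (Submodule.smul_mem _ _ (hD b m))
    · have e₁ : x ^ (b + m) * y ^ b = (x * y) ^ b * x ^ m := by
        rw [hxy.mul_pow, pow_add, mul_assoc, mul_assoc, (hxy.pow_pow m b).eq]
      have e₂ : x ^ b * y ^ (b + m) = (x * y) ^ b * y ^ m := by
        rw [hxy.mul_pow, pow_add, mul_assoc]
      rw [e₁, e₂, ← mul_assoc, (hc.pow_right b).eq, mul_assoc, hl, mul_sub, mul_smul_comm,
        neg_mul, smul_mul_assoc, sub_eq_add_neg]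
      simp only [mul_assoc]

end Relations

/-! ### Spanning -/

theorem commute_evalComm {A E ι : Type*} [CommRing A] [Ring E] [Algebra A E] {y : ι → E}
    (hy : ∀ i j, y i * y j = y j * y i) {x : E} (hx : ∀ i, Commute x (y i))
    (p : MvPolynomial ι A) : Commute x (evalComm y hy p) := by
  induction p using MvPolynomial.induction_on with
  | C a => rw [MvPolynomial.C_eq_algebraMap, AlgHom.commutes]; exact (Algebra.commutes a x).symm
  | add p q hp hq => rw [map_add]; exact hp.add_right hq
  | mul_X p i hp => rw [map_mul, evalComm_X]; exact hp.mul_right (hx i)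

theorem commute_evalComm_prod {A E ι : Type*} [CommRing A] [Ring E] [Algebra A E] {y : ι → E}
    (hy : ∀ i j, y i * y j = y j * y i) {x : E} (s : Finset ι) (hx : ∀ i ∈ s, Commute x (y i))
    (α : ι → ℕ) : Commute x (evalComm (A := A) y hy (∏ i ∈ s, MvPolynomial.X i ^ α i)) := by
  classical
  induction s using Finset.induction_on with
  | empty => rw [Finset.prod_empty, map_one]; exact Commute.one_right x
  | insert a s ha ih =>
    rw [Finset.prod_insert ha, map_mul, map_pow, evalComm_X]
    exact ((hx a (Finset.mem_insert_self a s)).pow_right _).mul_right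
      (ih fun i hi => hx i (Finset.mem_insert_of_mem hi))

/-- The elements of `E` whose left multiplication preserves the submodule `V`. -/
def stabilizer {A E : Type*} [CommRing A] [Ring E] [Algebra A E] (V : Submodule A E) :
    Subalgebra A E where
  carrier := {y | ∀ v ∈ V, y * v ∈ V}
  mul_mem' ha hb v hv := by rw [mul_assoc]; exact ha _ (hb _ hv)
  add_mem' ha hb v hv := by rw [add_mul]; exact V.add_mem (ha _ hv) (hb _ hv)
  algebraMap_mem' a v hv := by rw [← Algebra.smul_def]; exact V.smul_mem a hv

theorem mem_stabilizer_span {A E : Type*} [CommRing A] [Ring E] [Algebra A E] {S : Set E} {y : E}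
    (hy : ∀ v ∈ S, y * v ∈ Submodule.span A S) : y ∈ stabilizer (Submodule.span A S) := by
  intro v hv
  induction hv using Submodule.span_induction with
  | mem v hv => exact hy v hv
  | zero => rw [mul_zero]; exact Submodule.zero_mem _
  | add u v _ _ hu hv => rw [mul_add]; exact Submodule.add_mem _ hu hv
  | smul a v _ hv => rw [mul_smul_comm]; exact Submodule.smul_mem _ _ hv

namespace Relations

variable {A E : Type*} [CommRing A] [Ring E] [Algebra A E] {r n : ℕ} {z ri : A}
    {t : Fin n → E} {g : Fin (n - 1) → E} {X Xi : E}

/-- The monomial `X^α`. -/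
noncomputable def xMon (h : Relations r z ri t g X Xi) (α : Fin n → ℕ) : E :=
  evalComm (A := A) (fun i : Fin n => murphy g X i i.isLt) h.murphy_mul
    (∏ i, MvPolynomial.X i ^ α i)

/-- The value at `t` of a polynomial in `n` variables. -/
noncomputable def tPoly (h : Relations r z ri t g X Xi) : MvPolynomial (Fin n) A →ₐ[A] E :=
  evalComm t h.t_comm

variable (h : Relations r z ri t g X Xi)

/-- The span of the elements `X^α p(t) g_w` with `α_i < d`, where `p` is any polynomial. -/
noncomputable def boundedSpan (d : ℕ) (gw : Equiv.Perm (Fin n) → E) : Submodule A E :=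
  Submodule.span A {y | ∃ α : Fin n → ℕ, (∀ i, α i < d) ∧ ∃ p w, y = h.xMon α * h.tPoly p * gw w}

theorem g_mul_tPoly (i : Fin (n - 1)) (p : MvPolynomial (Fin n) A) :
    g i * h.tPoly p = h.tPoly (MvPolynomial.rename (simple i) p) * g i := by
  induction p using MvPolynomial.induction_on with
  | C a =>
    rw [MvPolynomial.rename_C, MvPolynomial.C_eq_algebraMap, AlgHom.commutes]
    exact (Algebra.commutes a _).symm
  | add p q hp hq => rw [map_add, map_add, map_add, mul_add, add_mul, hp, hq]
  | mul_X p j hp =>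
    rw [map_mul, map_mul, map_mul, ← mul_assoc, hp, MvPolynomial.rename_X, tPoly, evalComm_X,
      evalComm_X, mul_assoc, h.g_t, mul_assoc]

theorem tPoly_commute_xMon (p : MvPolynomial (Fin n) A) (α : Fin n → ℕ) :
    Commute (h.tPoly p) (h.xMon α) :=
  commute_evalComm h.murphy_mul (fun i : Fin n =>
    (commute_evalComm h.t_comm (fun j => (h.commute_t_murphy i i.isLt j).symm) p).symm) _

theorem exists_tPoly_eq_idem (i : Fin (n - 1)) : ∃ p, h.tPoly p = idem r ri t i := by
  refine ⟨ri • ∑ s ∈ Finset.range r, MvPolynomial.X (left i) ^ s *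
    MvPolynomial.X (right i) ^ (r - s), ?_⟩
  simp [tPoly, idem, map_sum]

theorem mul_mem_boundedSpan {d : ℕ} {gw : Equiv.Perm (Fin n) → E} {u : E}
    (hu : u ∈ Submodule.span A {y | ∃ α : Fin n → ℕ, (∀ i, α i < d) ∧ y = h.xMon α})
    (p : MvPolynomial (Fin n) A) (w : Equiv.Perm (Fin n)) :
    u * h.tPoly p * gw w ∈ h.boundedSpan d gw := by
  induction hu using Submodule.span_induction with
  | mem u hu =>
    obtain ⟨α, hα, rfl⟩ := hu
    exact Submodule.subset_span ⟨α, hα, p, w, rfl⟩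
  | zero => rw [zero_mul, zero_mul]; exact Submodule.zero_mem _
  | add u v _ _ hu hv => rw [add_mul, add_mul]; exact Submodule.add_mem _ hu hv
  | smul a v _ hv => rw [smul_mul_assoc, smul_mul_assoc]; exact Submodule.smul_mem _ _ hv

/-- `X^α` as a product of a part in `X_i`, `X_{i+1}` and a part commuting with `g_i`. -/
theorem exists_xMon_eq (i : Fin (n - 1)) (α : Fin n → ℕ) : ∃ y, Commute (g i) y ∧
    ∀ β : Fin n → ℕ, (∀ j, j ≠ left i → j ≠ right i → β j = α j) →
      h.xMon β = murphy g X (left i) (left i).isLt ^ β (left i) *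
        murphy g X (right i) (right i).isLt ^ β (right i) * y := by
  refine ⟨evalComm (A := A) (fun i : Fin n => murphy g X i i.isLt) h.murphy_mul
    (∏ j ∈ (Finset.univ.erase (left i)).erase (right i), MvPolynomial.X j ^ α j), ?_, ?_⟩
  · refine commute_evalComm_prod _ _ (fun j hj => ?_) _
    simp only [Finset.mem_erase, Finset.mem_univ, and_true] at hj
    refine h.commute_g_murphy i j j.isLt (fun hc => hj.2 (Fin.ext hc)) fun hc => hj.1 (Fin.ext hc)
  · intro β hβ
    rw [xMon, ← Finset.mul_prod_erase _ _ (Finset.mem_univ (left i)),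
      ← Finset.mul_prod_erase _ _ (Finset.mem_erase.2 ⟨(left_lt_right i).ne', Finset.mem_univ _⟩),
      ← mul_assoc, map_mul, map_mul, map_pow, map_pow, evalComm_X, evalComm_X]
    congr 2
    refine Finset.prod_congr rfl fun j hj => ?_
    simp only [Finset.mem_erase, Finset.mem_univ, and_true] at hj
    rw [hβ j hj.2 hj.1]

/-- Moving `g_i` through `X^α` permutes the exponents, up to bounded monomials times `e_i`. -/
theorem g_mul_xMon {d : ℕ} (i : Fin (n - 1)) (α : Fin n → ℕ) (hα : ∀ i, α i < d) :
    ∃ u ∈ Submodule.span A {y | ∃ α : Fin n → ℕ, (∀ i, α i < d) ∧ y = h.xMon α},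
      g i * h.xMon α = h.xMon (α ∘ simple i) * g i + u * idem r ri t i := by
  obtain ⟨y, hy, hxm⟩ := h.exists_xMon_eq i α
  obtain ⟨u, hu, hg⟩ := h.g_mul_pow_mul_pow i (α (left i)) (α (right i))
  have hey : Commute (idem r ri t i) y := by
    have := hxm (fun j => if j = left i ∨ j = right i then 0 else α j)
      (fun j h₁ h₂ => if_neg (by tauto))
    simp only [true_or, or_true, if_true, pow_zero, one_mul] at this
    rw [← this]
    obtain ⟨p, hp⟩ := h.exists_tPoly_eq_idem i
    rw [← hp]
    exact h.tPoly_commute_xMon _ _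
  refine ⟨u * y, ?_, ?_⟩
  · clear hg
    induction hu using Submodule.span_induction with
    | mem u hu =>
      obtain ⟨k, l, hk, hl, rfl⟩ := hu
      have hmax : max (α (left i)) (α (right i)) < d := max_lt (hα _) (hα _)
      refine Submodule.subset_span
        ⟨fun j => if j = left i then k else if j = right i then l else α j, fun j => ?_, ?_⟩
      · dsimp only
        split_ifs
        · omega
        · omega
        · exact hα j
      · rw [hxm _ fun j h₁ h₂ => by rw [if_neg h₁, if_neg h₂], if_pos rfl,
          if_neg (left_lt_right i).ne', if_pos rfl]
    | zero => rw [zero_mul]; exact Submodule.zero_mem _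
    | add u v _ _ hu hv => rw [add_mul]; exact Submodule.add_mem _ hu hv
    | smul a v _ hv => rw [smul_mul_assoc]; exact Submodule.smul_mem _ _ hv
  · rw [hxm α fun _ _ _ => rfl, hxm (α ∘ simple i) fun j h₁ h₂ => by
      rw [Function.comp_apply, simple_of_ne i h₁ h₂], ← mul_assoc, hg, add_mul,
      Function.comp_apply, Function.comp_apply, simple_left, simple_right, mul_assoc _ _ y, hy.eq,
      mul_assoc u, hey.eq]
    simp only [mul_assoc]

theorem g_mem_stabilizer {d : ℕ} {gw : Equiv.Perm (Fin n) → E}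
    (hgw : ∀ (i : Fin (n - 1)) (w : Equiv.Perm (Fin n)), g i * gw w = gw (simple i * w) ∨
      g i * gw w = gw (simple i * w) + z • (idem r ri t i * gw w)) (i : Fin (n - 1)) :
    g i ∈ stabilizer (h.boundedSpan d gw) := by
  refine mem_stabilizer_span ?_
  rintro _ ⟨α, hα, p, w, rfl⟩
  obtain ⟨u, hu, hg⟩ := h.g_mul_xMon i α hα
  obtain ⟨e, he⟩ := h.exists_tPoly_eq_idem i
  rw [← mul_assoc, ← mul_assoc, hg, ← he, add_mul, add_mul]
  refine Submodule.add_mem _ ?_ ?_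
  · rw [mul_assoc _ (g i), h.g_mul_tPoly, ← mul_assoc, mul_assoc _ (g i)]
    rcases hgw i w with hw | hw
    · rw [hw]
      exact Submodule.subset_span ⟨_, fun j => hα _, _, _, rfl⟩
    · rw [hw, mul_add]
      refine Submodule.add_mem _ (Submodule.subset_span ⟨_, fun j => hα _, _, _, rfl⟩) ?_
      rw [mul_smul_comm, ← he, ← mul_assoc, mul_assoc (h.xMon _), ← map_mul]
      exact Submodule.smul_mem _ _ (Submodule.subset_span ⟨_, fun j => hα _, _, _, rfl⟩)
  · rw [mul_assoc u, ← map_mul]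
    exact h.mul_mem_boundedSpan hu _ _

theorem tPoly_mem_stabilizer {d : ℕ} {gw : Equiv.Perm (Fin n) → E} (p : MvPolynomial (Fin n) A) :
    h.tPoly p ∈ stabilizer (h.boundedSpan d gw) := by
  refine mem_stabilizer_span ?_
  rintro _ ⟨α, hα, p', w, rfl⟩
  rw [← mul_assoc, ← mul_assoc, (h.tPoly_commute_xMon p α).eq, mul_assoc (h.xMon α), ← map_mul]
  exact Submodule.subset_span ⟨α, hα, _, _, rfl⟩

/-- Left multiplication by `X_1` raises only `α_1`, and the exponent `d` is lowered by the
polynomial relation for `X_1`. -/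
theorem X_mem_stabilizer {d : ℕ} {gw : Equiv.Perm (Fin n) → E} (hn : 0 < n)
    (hX : X ^ d ∈ Submodule.span A {y | ∃ k < d, y = X ^ k}) :
    X ∈ stabilizer (h.boundedSpan d gw) := by
  refine mem_stabilizer_span ?_
  rintro _ ⟨α, hα, p, w, rfl⟩
  have hsplit : ∀ k : ℕ, h.xMon (Function.update α ⟨0, hn⟩ k) =
      X ^ k * h.xMon (Function.update α ⟨0, hn⟩ 0) := by
    intro k
    simp only [xMon]
    rw [← Finset.mul_prod_erase _ _ (Finset.mem_univ (⟨0, hn⟩ : Fin n)), map_mul,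
      ← Finset.mul_prod_erase _ _ (Finset.mem_univ (⟨0, hn⟩ : Fin n))]
    simp only [Function.update_self, pow_zero, one_mul, map_pow, evalComm_X]
    congr 2
    refine Finset.prod_congr rfl fun j hj => ?_
    rw [Function.update_of_ne (Finset.ne_of_mem_erase hj),
      Function.update_of_ne (Finset.ne_of_mem_erase hj)]
  have hlt : ∀ k < d, ∀ i, Function.update α ⟨0, hn⟩ k i < d := by
    intro k hk i
    rw [Function.update_apply]
    split_ifs
    · exact hk
    · exact hα i
  rw [← mul_assoc, ← mul_assoc]
  refine h.mul_mem_boundedSpan ?_ p w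
  rw [← Function.update_eq_self ⟨0, hn⟩ α, hsplit, ← mul_assoc, ← pow_succ']
  rcases (Nat.succ_le_of_lt (hα ⟨0, hn⟩)).lt_or_eq with hd | hd
  · rw [← Nat.succ_eq_add_one, ← hsplit]
    exact Submodule.subset_span ⟨_, hlt _ hd, rfl⟩
  · rw [← Nat.succ_eq_add_one, hd]
    generalize X ^ d = y at hX ⊢
    induction hX using Submodule.span_induction with
    | mem u hu =>
      obtain ⟨k, hk, rfl⟩ := hu
      rw [← hsplit]
      exact Submodule.subset_span ⟨_, hlt _ hk, rfl⟩
    | zero => rw [zero_mul]; exact Submodule.zero_mem _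
    | add u v _ _ hu hv => rw [add_mul]; exact Submodule.add_mem _ hu hv
    | smul a v _ hv => rw [smul_mul_assoc]; exact Submodule.smul_mem _ _ hv

/-- Since `t_i^r = 1`, every polynomial in `t` is a combination of the `t^β` with `β_i < r`. -/
theorem tPoly_mem_span (hr : 0 < r) (p : MvPolynomial (Fin n) A) :
    h.tPoly p ∈ Submodule.span A (Set.range fun β : Fin n → Fin r =>
      h.tPoly (∏ i, MvPolynomial.X i ^ (β i : ℕ))) := by
  induction p using MvPolynomial.induction_on' with
  | monomial m a =>
    have hm : h.tPoly (MvPolynomial.monomial m a) =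
        a • h.tPoly (∏ i, MvPolynomial.X i ^ (m i % r)) := by
      rw [MvPolynomial.monomial_eq, map_mul, MvPolynomial.C_eq_algebraMap, AlgHom.commutes,
        ← Algebra.smul_def, Finsupp.prod_fintype _ _ (fun i => pow_zero _), ← List.prod_ofFn,
        ← List.prod_ofFn, map_list_prod, map_list_prod, List.map_ofFn, List.map_ofFn]
      congr 3
      funext i
      simp only [Function.comp_apply, map_pow, tPoly, evalComm_X]
      conv_lhs => rw [← Nat.mod_add_div (m i) r, pow_add, pow_mul, h.t_pow, one_pow, mul_one]
    rw [hm]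
    exact Submodule.smul_mem _ _ (Submodule.subset_span ⟨fun i => ⟨m i % r, Nat.mod_lt _ hr⟩, rfl⟩)
  | add p q hp hq => rw [map_add]; exact Submodule.add_mem _ hp hq

theorem boundedSpan_le (hr : 0 < r) (d : ℕ) (gw : Equiv.Perm (Fin n) → E) :
    h.boundedSpan d gw ≤ Submodule.span A (Set.range
      fun x : (Fin n → Fin d) × (Fin n → Fin r) × Equiv.Perm (Fin n) =>
        h.xMon (fun i => x.1 i) * h.tPoly (∏ i, MvPolynomial.X i ^ (x.2.1 i : ℕ)) * gw x.2.2) := by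
  refine Submodule.span_le.2 ?_
  rintro _ ⟨α, hα, p, w, rfl⟩
  have hp := h.tPoly_mem_span hr p
  rw [SetLike.mem_coe]
  generalize h.tPoly p = y at hp ⊢
  induction hp using Submodule.span_induction with
  | mem u hu =>
    obtain ⟨β, rfl⟩ := hu
    exact Submodule.subset_span ⟨(fun i => ⟨α i, hα i⟩, β, w), rfl⟩
  | zero => rw [mul_zero, zero_mul]; exact Submodule.zero_mem _
  | add u v _ _ hu hv => rw [mul_add, add_mul]; exact Submodule.add_mem _ hu hv
  | smul a v _ hv => rw [mul_smul_comm, smul_mul_assoc]; exact Submodule.smul_mem _ _ hv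

include h in
/-- Left multiplication of `g_w` by `g_i`, by Matsumoto's lemma and the quadratic relation. -/
theorem g_mul_prod_word {word : Equiv.Perm (Fin n) → List (Fin (n - 1))}
    (hword : ∀ w, IsReducedWord w (word w)) (i : Fin (n - 1)) (w : Equiv.Perm (Fin n)) :
    g i * ((word w).map g).prod = ((word (simple i * w)).map g).prod ∨
      g i * ((word w).map g).prod = ((word (simple i * w)).map g).prod +
        z • (idem r ri t i * ((word w).map g).prod) := by
  rcases inv_left_lt_or i w with hi | hi
  · left
    rw [prod_eq_of_isReducedWord g h.g_comm h.g_braid _ _ _ (hword (simple i * w))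
      ((hword w).cons_of_lt hi), List.map_cons, List.prod_cons]
  · right
    have hw : ((word w).map g).prod = g i * ((word (simple i * w)).map g).prod := by
      rw [prod_eq_of_isReducedWord g h.g_comm h.g_braid _ _ _ (hword w)
        ((hword (simple i * w)).cons_of_gt hi), List.map_cons, List.prod_cons]
    rw [hw, ← mul_assoc, h.g_sq, add_mul, one_mul, smul_mul_assoc, mul_assoc]

include h in
/-- If `X_1` satisfies a monic polynomial relation of degree `d` with invertible constant term,
then the elements `X^α t^β g_w` span the algebra generated by `t`, `g` and `X_1`. -/
theorem span_eq_top (hr : 0 < r) (hn : 0 < n) {d : ℕ} (hd : 0 < d)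
    {word : Equiv.Perm (Fin n) → List (Fin (n - 1))} (hword : ∀ w, IsReducedWord w (word w))
    (hX : X ^ d ∈ Submodule.span A {y | ∃ k < d, y = X ^ k}) (hXi : Xi ∈ Algebra.adjoin A {X})
    (hgen : Algebra.adjoin A (Set.range t ∪ Set.range g ∪ {X, Xi}) = ⊤) :
    Submodule.span A (Set.range
      fun x : (Fin n → Fin d) × (Fin n → Fin r) × Equiv.Perm (Fin n) =>
        (List.ofFn fun i : Fin n => murphy g X i i.isLt ^ (x.1 i : ℕ)).prod *
          (List.ofFn fun i : Fin n => t i ^ (x.2.1 i : ℕ)).prod *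
            ((word x.2.2).map g).prod) = ⊤ := by
  have hle := h.boundedSpan_le hr d fun w => ((word w).map g).prod
  have hXmem := h.X_mem_stabilizer (gw := fun w => ((word w).map g).prod) hn hX
  have htop : stabilizer (h.boundedSpan d fun w => ((word w).map g).prod) = ⊤ := by
    rw [eq_top_iff, ← hgen]
    refine Algebra.adjoin_le ?_
    rintro _ ((⟨j, rfl⟩ | ⟨i, rfl⟩) | rfl | rfl)
    · have := h.tPoly_mem_stabilizer (d := d) (gw := fun w => ((word w).map g).prod)
        (MvPolynomial.X j)
      rwa [tPoly, evalComm_X] at this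
    · exact h.g_mem_stabilizer (h.g_mul_prod_word hword) i
    · exact hXmem
    · exact Algebra.adjoin_le (Set.singleton_subset_iff.2 hXmem) hXi
  have hone : (1 : E) ∈ h.boundedSpan d fun w => ((word w).map g).prod := by
    refine Submodule.subset_span ⟨0, fun _ => hd, 1, 1, ?_⟩
    have hnil : word 1 = [] := List.length_eq_zero_iff.1
      ((isReducedWord_iff.1 (hword 1)).2.trans inversionNumber_one)
    simp [xMon, hnil]
  rw [eq_top_iff]
  intro y _
  have hy : y ∈ stabilizer (h.boundedSpan d fun w => ((word w).map g).prod) := by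
    rw [htop]
    trivial
  have := hle (hy 1 hone)
  rw [mul_one] at this
  simpa only [xMon, tPoly, ← ofFn_prod_eq_evalComm] using this

end Relations

/-! ### Operators on tensor space -/

section SwapAt

variable {Λ : Type*}

/-- The word obtained from `u` by exchanging the letters at positions `i` and `i + 1`. -/
def swapAt (u : ℕ → Λ) (i : ℕ) : ℕ → Λ := fun j => u (Equiv.swap i (i + 1) j)

theorem swapAt_left (u : ℕ → Λ) (i : ℕ) : swapAt u i i = u (i + 1) := by simp [swapAt]

theorem swapAt_right (u : ℕ → Λ) (i : ℕ) : swapAt u i (i + 1) = u i := by simp [swapAt]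

theorem swapAt_of_ne (u : ℕ → Λ) {i j : ℕ} (h₁ : j ≠ i) (h₂ : j ≠ i + 1) :
    swapAt u i j = u j := by
  simp [swapAt, Equiv.swap_apply_of_ne_of_ne h₁ h₂]

theorem swapAt_swapAt (u : ℕ → Λ) (i : ℕ) : swapAt (swapAt u i) i = u := by
  ext j
  simp [swapAt]

theorem swapAt_eq_self {u : ℕ → Λ} {i : ℕ} (h : u i = u (i + 1)) : swapAt u i = u := by
  ext j
  by_cases h₁ : j = i
  · rw [h₁, swapAt_left, h]
  by_cases h₂ : j = i + 1
  · rw [h₂, swapAt_right, h]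
  exact swapAt_of_ne u h₁ h₂

theorem swapAt_comm (u : ℕ → Λ) {i j : ℕ} (h : i + 2 ≤ j) :
    swapAt (swapAt u i) j = swapAt (swapAt u j) i := by
  ext k
  simp only [swapAt, Equiv.swap_apply_def]
  congr 1
  split_ifs <;> omega

theorem swapAt_braid (u : ℕ → Λ) (i : ℕ) :
    swapAt (swapAt (swapAt u i) (i + 1)) i = swapAt (swapAt (swapAt u (i + 1)) i) (i + 1) := by
  ext k
  simp only [swapAt, Equiv.swap_apply_def]
  congr 1
  split_ifs <;> omega

end SwapAt

section Operators

variable {Λ Cl C : Type*} [LinearOrder Λ] [DecidableEq Cl] [CommRing C]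

/-- The space of functions on words. Words are infinite to the right, so that no operator has to
treat the end of a word separately; only the first `n` positions matter for the algebra with
parameter `n`. -/
abbrev WordFun (Λ C : Type*) : Type _ := (ℕ → Λ) → C

/-- Multiplication by a function on words. -/
abbrev diag (f : WordFun Λ C) : Module.End C (WordFun Λ C) := Algebra.lmul C (WordFun Λ C) f

/-- The indicator function of the words whose letters at `i` and `i + 1` are in the same class. -/
def sameClass (C : Type*) [CommRing C] (cl : Λ → Cl) (i : ℕ) : WordFun Λ C :=
  fun u => if cl (u i) = cl (u (i + 1)) then 1 else 0

/-- The Jimbo R-matrix at positions `i` and `i + 1`, for letters divided into classes by `cl`: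
letters of the same class interact, letters of different classes are just exchanged. -/
def rMatrix (q z : C) (cl : Λ → Cl) (i : ℕ) : Module.End C (WordFun Λ C) where
  toFun F u := if u i = u (i + 1) then q * F u else F (swapAt u i) +
    (if cl (u i) = cl (u (i + 1)) ∧ u (i + 1) < u i then z else 0) * F u
  map_add' F G := by
    ext u
    simp only [Pi.add_apply]
    split_ifs <;> ring
  map_smul' a F := by
    ext u
    simp only [Pi.smul_apply, smul_eq_mul, RingHom.id_apply]
    split_ifs <;> ring

theorem rMatrix_apply (q z : C) (cl : Λ → Cl) (i : ℕ) (F : WordFun Λ C) (u : ℕ → Λ) :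
    rMatrix q z cl i F u = if u i = u (i + 1) then q * F u else F (swapAt u i) +
      (if cl (u i) = cl (u (i + 1)) ∧ u (i + 1) < u i then z else 0) * F u := rfl

omit [LinearOrder Λ] in
theorem diag_apply (f F : WordFun Λ C) (u : ℕ → Λ) : diag f F u = f u * F u := rfl

theorem rMatrix_comm (q z : C) {Cl' : Type*} [DecidableEq Cl'] (cl : Λ → Cl) (cl' : Λ → Cl')
    {i j : ℕ} (h : i + 2 ≤ j) :
    rMatrix q z cl i * rMatrix q z cl' j = rMatrix q z cl' j * rMatrix q z cl i := by
  ext F u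
  simp only [Module.End.mul_apply, rMatrix_apply,
    swapAt_of_ne u (show j ≠ i by omega) (show j ≠ i + 1 by omega),
    swapAt_of_ne u (show j + 1 ≠ i by omega) (show j + 1 ≠ i + 1 by omega),
    swapAt_of_ne u (show i ≠ j by omega) (show i ≠ j + 1 by omega),
    swapAt_of_ne u (show i + 1 ≠ j by omega) (show i + 1 ≠ j + 1 by omega), swapAt_comm u h]
  split_ifs <;> ring

theorem rMatrix_braid {q z : C} (hq : q * q = 1 + z * q) (cl : Λ → Cl) (i : ℕ) :
    rMatrix q z cl i * rMatrix q z cl (i + 1) * rMatrix q z cl i =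
      rMatrix q z cl (i + 1) * rMatrix q z cl i * rMatrix q z cl (i + 1) := by
  ext F u
  have e₁ : ∀ u : ℕ → Λ, swapAt u i (i + 1 + 1) = u (i + 1 + 1) := fun u =>
    swapAt_of_ne u (by omega) (by omega)
  have e₂ : ∀ u : ℕ → Λ, swapAt u (i + 1) i = u i := fun u =>
    swapAt_of_ne u (by omega) (by omega)
  simp only [Module.End.mul_apply, rMatrix_apply, swapAt_left, swapAt_right, e₁, e₂,
    swapAt_swapAt, ← swapAt_braid]
  generalize F (swapAt (swapAt (swapAt u i) (i + 1)) i) = f₁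
  generalize F (swapAt (swapAt u i) (i + 1)) = f₂
  generalize F (swapAt (swapAt u (i + 1)) i) = f₃
  generalize F (swapAt u i) = f₄
  generalize F (swapAt u (i + 1)) = f₅
  generalize F u = f₆
  generalize u i = a
  generalize u (i + 1) = b
  generalize u (i + 1 + 1) = c
  -- only the relative order of the three letters and the coincidences of their classes matter
  rcases lt_trichotomy a b with hab | hab | hab <;>
    rcases lt_trichotomy b c with hbc | hbc | hbc <;>
    rcases lt_trichotomy a c with hac | hac | hac <;> first | (exfalso; order) | skip
  all_goals
    by_cases h₁ : cl a = cl b <;> by_cases h₂ : cl b = cl c <;> by_cases h₃ : cl a = cl c <;>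
      first | (exfalso; simp_all; done) | skip
  all_goals
    try have h₁' := Ne.symm h₁
    try have h₂' := Ne.symm h₂
    try have h₃' := Ne.symm h₃
    try subst hab
    try subst hbc
    simp [*, ne_of_lt, ne_of_gt, lt_asymm]
    try grind
end Operators

/-! ### The operator representing `X_1` -/

/-- The element `T_k⁻¹ T_{k+1}⁻¹ ⋯ T_{k+j-1}⁻¹ ω_{k+j} S_{k+j-1} ⋯ S_k`. -/
def twistedCycle {G : Type*} [Group G] (T S ω : ℕ → G) : ℕ → ℕ → G
  | 0, k => ω k
  | j + 1, k => (T k)⁻¹ * twistedCycle T S ω j (k + 1) * S k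

/-- Two families `T`, `S` satisfying the braid relations, also in mixed form, and a family `ω`
that is permuted by the elements `S`. These are the identities behind the relations of `X_1`. -/
structure BraidPair {G : Type*} [Group G] (T S ω : ℕ → G) : Prop where
  T_comm : ∀ i j, i + 2 ≤ j → Commute (T i) (T j)
  T_braid : ∀ i, T i * T (i + 1) * T i = T (i + 1) * T i * T (i + 1)
  S_comm : ∀ i j, i + 2 ≤ j → Commute (S i) (S j)
  S_braid : ∀ i, S i * S (i + 1) * S i = S (i + 1) * S i * S (i + 1)
  S_comm_T : ∀ i j, i + 2 ≤ j ∨ j + 2 ≤ i → Commute (S i) (T j)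
  S_S_T : ∀ i, S i * S (i + 1) * T i = T (i + 1) * S i * S (i + 1)
  S_S_T' : ∀ i, S (i + 1) * S i * T (i + 1) = T i * S (i + 1) * S i
  S_ω : ∀ i, S i * ω (i + 1) = ω i * S i
  S_comm_ω : ∀ i k, k ≠ i → k ≠ i + 1 → Commute (S i) (ω k)
  T_comm_ω : ∀ i k, k ≠ i → k ≠ i + 1 → Commute (T i) (ω k)
  T_comm_ω_ω : ∀ i, Commute (T i) (ω (i + 1) * ω i)
  T_comm_S_S : ∀ i, Commute (T i) (S i * S i)

theorem mul_inv_mul_inv_of_braid {G : Type*} [Group G] {a b : G} (h : a * b * a = b * a * b) :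
    a * b⁻¹ * a⁻¹ = b⁻¹ * a⁻¹ * b := by
  calc a * b⁻¹ * a⁻¹ = b⁻¹ * a⁻¹ * (a * b * a) * b⁻¹ * a⁻¹ := by group
    _ = b⁻¹ * a⁻¹ * b := by rw [h]; group

namespace BraidPair

variable {G : Type*} [Group G] {T S ω : ℕ → G} (h : BraidPair T S ω)
include h

theorem S_comm_twistedCycle (j : ℕ) : ∀ i k, i + 2 ≤ k →
    Commute (S i) (twistedCycle T S ω j k) := by
  induction j with
  | zero => exact fun i k hk => h.S_comm_ω i k (by omega) (by omega)
  | succ j ih =>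
    exact fun i k hk => (((h.S_comm_T i k (Or.inl hk)).inv_right).mul_right
      (ih i (k + 1) (by omega))).mul_right (h.S_comm i k hk)

theorem T_comm_twistedCycle_of_lt (j : ℕ) : ∀ i k, i + 2 ≤ k →
    Commute (T i) (twistedCycle T S ω j k) := by
  induction j with
  | zero => exact fun i k hk => h.T_comm_ω i k (by omega) (by omega)
  | succ j ih =>
    exact fun i k hk => (((h.T_comm i k hk).inv_right).mul_right
      (ih i (k + 1) (by omega))).mul_right (h.S_comm_T k i (Or.inr hk)).symm

/-- The relations `g_i X_1 = X_1 g_i`. -/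
theorem T_comm_twistedCycle (j : ℕ) : ∀ i k, k < i → i < k + j →
    Commute (T i) (twistedCycle T S ω j k) := by
  induction j with
  | zero => intro i k h₁ h₂; omega
  | succ j ih =>
    intro i k h₁ h₂
    rcases (Nat.succ_le_of_lt h₁).eq_or_lt with rfl | hlt
    · obtain ⟨j, rfl⟩ : ∃ m, j = m + 1 := ⟨j - 1, by omega⟩
      have hz := (h.T_comm_twistedCycle_of_lt j k (k + 1 + 1) (by omega)).eq
      have hb := h.T_braid k
      have hm := h.S_S_T' k
      simp only [twistedCycle, Nat.succ_eq_add_one]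
      generalize twistedCycle T S ω j (k + 1 + 1) = Z at hz ⊢
      generalize T k = T₁ at *
      generalize T (k + 1) = T₂ at *
      generalize S k = S₁ at *
      generalize S (k + 1) = S₂ at *
      have hb' : T₂ * T₁⁻¹ * T₂⁻¹ = T₁⁻¹ * T₂⁻¹ * T₁ := mul_inv_mul_inv_of_braid hb.symm
      rw [Commute, SemiconjBy]
      calc T₂ * (T₁⁻¹ * (T₂⁻¹ * Z * S₂) * S₁) = T₂ * T₁⁻¹ * T₂⁻¹ * Z * S₂ * S₁ := by
            simp only [mul_assoc]
        _ = T₁⁻¹ * T₂⁻¹ * (T₁ * Z) * S₂ * S₁ := by rw [hb']; simp only [mul_assoc]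
        _ = T₁⁻¹ * T₂⁻¹ * Z * (T₁ * S₂ * S₁) := by rw [hz]; simp only [mul_assoc]
        _ = T₁⁻¹ * (T₂⁻¹ * Z * S₂) * S₁ * T₂ := by rw [← hm]; simp only [mul_assoc]
    · exact (((h.T_comm k i hlt).symm.inv_right).mul_right (ih i (k + 1) hlt (by omega))).mul_right
        (h.S_comm_T k i (Or.inl hlt)).symm

/-- The relation `g_1 X_1 g_1 X_1 = X_1 g_1 X_1 g_1` reduces to this commutation, which passes
from position `k + 1` to position `k`. -/
theorem T_comm_twistedCycle_S_sq (j : ℕ) : ∀ k,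
    Commute (T k) (twistedCycle T S ω j (k + 1) * S k * twistedCycle T S ω j (k + 1) * S k) := by
  induction j with
  | zero =>
    intro k
    have : ω (k + 1) * S k * ω (k + 1) * S k = ω (k + 1) * ω k * (S k * S k) := by
      rw [mul_assoc (ω (k + 1)) (S k), h.S_ω]
      simp only [mul_assoc]
    simp only [twistedCycle]
    rw [this]
    exact (h.T_comm_ω_ω k).mul_right (h.T_comm_S_S k)
  | succ j ih =>
    intro k
    have hc := (ih (k + 1)).eq
    have hz := (h.T_comm_twistedCycle_of_lt j k (k + 1 + 1) (by omega)).inv_left.eq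
    have hz' := (h.S_comm_twistedCycle j k (k + 1 + 1) (by omega)).eq
    have hb := h.T_braid k
    have hsb := h.S_braid k
    have hm := h.S_S_T k
    have hm' := h.S_S_T' k
    simp only [twistedCycle]
    generalize twistedCycle T S ω j (k + 1 + 1) = Z at *
    generalize T k = T₁ at *
    generalize T (k + 1) = T₂ at *
    generalize S k = S₁ at *
    generalize S (k + 1) = S₂ at *
    have hb' : T₁ * T₂⁻¹ * T₁⁻¹ = T₂⁻¹ * T₁⁻¹ * T₂ := mul_inv_mul_inv_of_braid hb
    have hm₂ : S₂ * S₁ * T₂⁻¹ = T₁⁻¹ * (S₂ * S₁) := by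
      rw [mul_inv_eq_iff_eq_mul, mul_assoc, hm', mul_assoc, inv_mul_cancel_left]
    have e : T₂⁻¹ * Z * S₂ * S₁ * (T₂⁻¹ * Z * S₂) * S₁ =
        T₂⁻¹ * T₁⁻¹ * (Z * S₂ * Z * S₂) * (S₁ * S₂) := by
      calc T₂⁻¹ * Z * S₂ * S₁ * (T₂⁻¹ * Z * S₂) * S₁
          = T₂⁻¹ * Z * (S₂ * S₁ * T₂⁻¹) * Z * S₂ * S₁ := by simp only [mul_assoc]
        _ = T₂⁻¹ * (Z * T₁⁻¹) * S₂ * (S₁ * Z) * S₂ * S₁ := by rw [hm₂]; simp only [mul_assoc]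
        _ = T₂⁻¹ * T₁⁻¹ * Z * S₂ * Z * (S₁ * S₂ * S₁) := by
            rw [← hz, hz']; simp only [mul_assoc]
        _ = _ := by rw [hsb]; simp only [mul_assoc]
    rw [e, Commute, SemiconjBy]
    calc T₁ * (T₂⁻¹ * T₁⁻¹ * (Z * S₂ * Z * S₂) * (S₁ * S₂))
        = T₁ * T₂⁻¹ * T₁⁻¹ * (Z * S₂ * Z * S₂) * (S₁ * S₂) := by simp only [mul_assoc]
      _ = T₂⁻¹ * T₁⁻¹ * (T₂ * (Z * S₂ * Z * S₂)) * (S₁ * S₂) := by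
          rw [hb']; simp only [mul_assoc]
      _ = T₂⁻¹ * T₁⁻¹ * (Z * S₂ * Z * S₂) * (T₂ * S₁ * S₂) := by
          rw [hc]; simp only [mul_assoc]
      _ = _ := by rw [← hm]; simp only [mul_assoc]

/-- The relation `g_1 X_1 g_1 X_1 = X_1 g_1 X_1 g_1`. -/
theorem T_twistedCycle_T_twistedCycle (j k : ℕ) :
    T k * twistedCycle T S ω (j + 1) k * T k * twistedCycle T S ω (j + 1) k =
      twistedCycle T S ω (j + 1) k * T k * twistedCycle T S ω (j + 1) k * T k := by
  have hc := (h.T_comm_twistedCycle_S_sq j k).eq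
  simp only [twistedCycle]
  generalize twistedCycle T S ω j (k + 1) = Z at *
  generalize T k = T₁ at *
  generalize S k = S₁ at *
  calc T₁ * (T₁⁻¹ * Z * S₁) * T₁ * (T₁⁻¹ * Z * S₁) = T₁⁻¹ * (T₁ * (Z * S₁ * Z * S₁)) := by group
    _ = _ := by rw [hc]; group

end BraidPair

/-- An element `t k` whose index is permuted in the same way by `T` and `S` commutes with
`twistedCycle`. -/
theorem commute_twistedCycle {G : Type*} [Group G] {T S ω : ℕ → G} {t : ℕ → G}
    (hT : ∀ i k, T i * t k = t (Equiv.swap i (i + 1) k) * T i)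
    (hS : ∀ i k, S i * t k = t (Equiv.swap i (i + 1) k) * S i)
    (hω : ∀ i k, Commute (t k) (ω i)) (j : ℕ) :
    ∀ k l, Commute (t l) (twistedCycle T S ω j k) := by
  induction j with
  | zero => exact fun k l => hω k l
  | succ j ih =>
    intro k l
    have h₁ : t l * (T k)⁻¹ = (T k)⁻¹ * t (Equiv.swap k (k + 1) l) := by
      rw [mul_inv_eq_iff_eq_mul, mul_assoc, eq_inv_mul_iff_mul_eq, hT]
    rw [Commute, SemiconjBy, twistedCycle, mul_assoc _ (S k), hS, ← mul_assoc, ← mul_assoc, h₁,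
      mul_assoc (T k)⁻¹, (ih (k + 1) (Equiv.swap k (k + 1) l)).eq]
    simp only [mul_assoc]

/-! ### Relations between the operators -/

section TensorRep

variable {Λ Cl C : Type*} [LinearOrder Λ] [DecidableEq Cl] [CommRing C]

/-- Multiplication by a function of the classes of the letters of a word. -/
abbrev classDiag (cl : Λ → Cl) (φ : (ℕ → Cl) → C) : Module.End C (WordFun Λ C) :=
  diag fun u => φ fun j => cl (u j)

omit [LinearOrder Λ] [DecidableEq Cl] in
theorem class_swapAt {cl : Λ → Cl} (u : ℕ → Λ) (i : ℕ) :
    (fun j => cl (swapAt u i j)) = swapAt (fun j => cl (u j)) i := rfl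

/-- A multiplication operator that depends only on classes is permuted by the R-matrix, because the
extra term of the R-matrix occurs only where the two letters have the same class. -/
theorem rMatrix_mul_classDiag (q z : C) (cl : Λ → Cl) (i : ℕ) (φ : (ℕ → Cl) → C) :
    rMatrix q z cl i * classDiag cl φ =
      classDiag cl (fun c => φ (swapAt c i)) * rMatrix q z cl i := by
  ext F u
  have key : cl (u i) = cl (u (i + 1)) →
      swapAt (fun j => cl (u j)) i = fun j => cl (u j) := fun h => swapAt_eq_self h
  simp only [Module.End.mul_apply, rMatrix_apply, diag_apply, class_swapAt]
  by_cases h₁ : u i = u (i + 1)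
  · rw [key (by rw [h₁]), if_pos h₁, if_pos h₁]
    ring
  · rw [if_neg h₁, if_neg h₁]
    by_cases h₂ : cl (u i) = cl (u (i + 1))
    · rw [key h₂]
      ring
    · rw [if_neg fun h => h₂ h.1]
      ring

theorem rMatrix_sq {q z : C} (hq : q * q = 1 + z * q) (cl : Λ → Cl) (i : ℕ) :
    rMatrix q z cl i * rMatrix q z cl i =
      1 + z • (diag (sameClass C cl i) * rMatrix q z cl i) := by
  ext F u
  simp only [Module.End.mul_apply, rMatrix_apply, LinearMap.add_apply, LinearMap.smul_apply,
    Pi.add_apply, Pi.smul_apply, diag_apply, sameClass, swapAt_left, swapAt_right, swapAt_swapAt,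
    Module.End.one_apply, smul_eq_mul]
  by_cases h₁ : u i = u (i + 1)
  · simp only [h₁, if_true]
    linear_combination F u * hq
  · by_cases h₂ : cl (u i) = cl (u (i + 1))
    · rcases lt_or_gt_of_ne h₁ with h₃ | h₃
      · simp [h₁, Ne.symm h₁, h₂, h₃, h₃.not_gt]
      · simp [h₁, Ne.symm h₁, h₂, h₃, h₃.not_gt]
    · simp [h₁, Ne.symm h₁, h₂, Ne.symm h₂]

omit [LinearOrder Λ] in
theorem sameClass_eq (cl : Λ → Cl) (i : ℕ) :
    diag (sameClass C cl i) = classDiag cl fun c => if c i = c (i + 1) then 1 else 0 := rfl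

theorem rMatrix_commute_sameClass (q z : C) (cl : Λ → Cl) (i : ℕ) :
    Commute (rMatrix q z cl i) (diag (sameClass C cl i)) := by
  rw [Commute, SemiconjBy, sameClass_eq, rMatrix_mul_classDiag]
  simp only [swapAt_left, swapAt_right, eq_comm]

theorem unit_mul_self (q : Cˣ) : (q : C) * q = 1 + ((q : C) - (q⁻¹ : Cˣ)) * q := by
  rw [sub_mul, Units.inv_mul]
  ring

/-- The R-matrix with `z = q - q⁻¹` as a unit. -/
def rUnit (q : Cˣ) (cl : Λ → Cl) (i : ℕ) : (Module.End C (WordFun Λ C))ˣ where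
  val := rMatrix (q : C) (q - (q⁻¹ : Cˣ)) cl i
  inv := rMatrix (q : C) (q - (q⁻¹ : Cˣ)) cl i -
    ((q : C) - (q⁻¹ : Cˣ)) • diag (sameClass C cl i)
  val_inv := by
    rw [mul_sub, rMatrix_sq (unit_mul_self q), mul_smul_comm,
      (rMatrix_commute_sameClass _ _ _ _).eq, add_sub_cancel_right]
  inv_val := by
    rw [sub_mul, rMatrix_sq (unit_mul_self q), smul_mul_assoc, add_sub_cancel_right]

/-- Multiplication by an invertible function on words, as a unit. -/
def diagUnit (f : (ℕ → Λ) → Cˣ) : (Module.End C (WordFun Λ C))ˣ where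
  val := diag fun u => (f u : C)
  inv := diag fun u => ((f u)⁻¹ : Cˣ)
  val_inv := by
    rw [diag, diag, ← map_mul, ← map_one (Algebra.lmul C (WordFun Λ C))]
    congr 1
    ext u
    simp
  inv_val := by
    rw [diag, diag, ← map_mul, ← map_one (Algebra.lmul C (WordFun Λ C))]
    congr 1
    ext u
    simp

omit [LinearOrder Λ] in
theorem diag_commute (f f' : WordFun Λ C) : Commute (diag f) (diag f') :=
  (Commute.all f f').map (Algebra.lmul C (WordFun Λ C))

variable (q : Cˣ) (τ : Λ → Cl) (β : Λ → ℕ)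

/-- The indicator function of the words whose letters at `i` and `i + 1` have the same class `τ`
and strictly decreasing values of `β`. -/
def descent (τ : Λ → Cl) (β : Λ → ℕ) (i : ℕ) : WordFun Λ C := fun u =>
  if τ (u i) = τ (u (i + 1)) ∧ β (u (i + 1)) < β (u i) then 1 else 0

/-- The finer division of letters into classes, by the values of `τ` and of `β`. -/
abbrev fineClass (τ : Λ → Cl) (β : Λ → ℕ) : Λ → Cl × ℕ := fun x => (τ x, β x)

/-- The two R-matrices differ by a multiplication operator. Monotonicity of `β` makes a strict
descent of `β` a descent of letters. -/
theorem rMatrix_eq_add_descent {β : Λ → ℕ} (hβ : Monotone β) (q z : C) (i : ℕ) :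
    rMatrix q z τ i = rMatrix q z (fineClass τ β) i + z • diag (descent (C := C) τ β i) := by
  ext F u
  simp only [rMatrix_apply, LinearMap.add_apply, LinearMap.smul_apply, Pi.add_apply, Pi.smul_apply,
    diag_apply, descent, smul_eq_mul, Prod.mk.injEq]
  by_cases h₁ : u i = u (i + 1)
  · simp [h₁]
  · by_cases h₂ : τ (u i) = τ (u (i + 1))
    · rcases lt_trichotomy (β (u (i + 1))) (β (u i)) with h₃ | h₃ | h₃
      · have : u (i + 1) < u i := hβ.reflect_lt h₃
        simp [h₁, h₂, h₃, h₃.ne', this]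
      · simp [h₁, h₂, h₃]
      · have : ¬ u (i + 1) < u i := fun h => (hβ h.le).not_gt h₃
        simp [h₁, h₂, h₃.ne, h₃.not_gt, this]
    · simp [h₁, h₂]

omit [LinearOrder Λ] in
theorem descent_eq (i : ℕ) : diag (descent (C := C) τ β i) = classDiag (fineClass τ β)
    fun c => if (c i).1 = (c (i + 1)).1 ∧ (c (i + 1)).2 < (c i).2 then 1 else 0 := rfl

/-- The operators `g_i` on tensor space. -/
abbrev opT (i : ℕ) : (Module.End C (WordFun Λ C))ˣ := rUnit q τ i

/-- The operators on tensor space in which only the letters of the same fine class interact. -/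
abbrev opS (i : ℕ) : (Module.End C (WordFun Λ C))ˣ := rUnit q (fineClass τ β) i

/-- Multiplication by the value of `v` on the letter at position `k`. -/
abbrev opω (v : ℕ → Cˣ) (k : ℕ) : (Module.End C (WordFun Λ C))ˣ := diagUnit fun u => v (β (u k))

theorem opT_val {β : Λ → ℕ} (hβ : Monotone β) (i : ℕ) :
    (opT (C := C) q τ i : Module.End C (WordFun Λ C)) = opS q τ β i +
      ((q : C) - (q⁻¹ : Cˣ)) • diag (descent (C := C) τ β i) :=
  rMatrix_eq_add_descent τ hβ _ _ i

theorem opS_mul_classDiag (i : ℕ) (φ : (ℕ → Cl × ℕ) → C) :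
    (opS q τ β i : Module.End C (WordFun Λ C)) * classDiag (fineClass τ β) φ =
      classDiag (fineClass τ β) (fun c => φ (swapAt c i)) * opS q τ β i :=
  rMatrix_mul_classDiag _ _ _ _ _

omit [LinearOrder Λ] [DecidableEq Cl] in
theorem opω_val (v : ℕ → Cˣ) (k : ℕ) : (opω β v k : Module.End C (WordFun Λ C)) =
    classDiag (fineClass τ β) fun c => (v (c k).2 : C) := rfl

/-- Each relation between `T` and `S` reduces, by `opT_val`, to one for `S` and one for the
multiplication operators `descent`, which depend only on fine classes. -/
theorem braidPair {β : Λ → ℕ} (hβ : Monotone β) (v : ℕ → Cˣ) :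
    BraidPair (opT (C := C) q τ) (opS q τ β) (opω β v) := by
  have hSω : ∀ i k, k ≠ i → k ≠ i + 1 → Commute (opS q τ β i) (opω (C := C) β v k) := by
    intro i k h₁ h₂
    rw [← Commute.units_val_iff, opω_val τ, Commute, SemiconjBy, opS_mul_classDiag]
    simp only [swapAt_of_ne _ h₁ h₂]
  have hSD : ∀ i, Commute (opS q τ β i * opS q τ β i : Module.End C (WordFun Λ C))
      (diag (descent (C := C) τ β i)) := by
    intro i
    rw [Commute, SemiconjBy, descent_eq, mul_assoc, opS_mul_classDiag, ← mul_assoc,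
      opS_mul_classDiag, mul_assoc]
    simp only [swapAt_swapAt]
  refine ⟨?_, ?_, ?_, ?_, ?_, ?_, ?_, ?_, hSω, ?_, ?_, ?_⟩
  · exact fun i j hij => Units.ext (rMatrix_comm _ _ _ _ hij)
  · exact fun i => Units.ext (rMatrix_braid (unit_mul_self q) _ _)
  · exact fun i j hij => Units.ext (rMatrix_comm _ _ _ _ hij)
  · exact fun i => Units.ext (rMatrix_braid (unit_mul_self q) _ _)
  · rintro i j (hij | hij)
    · exact Units.ext (rMatrix_comm _ _ _ _ hij)
    · exact Units.ext (rMatrix_comm _ _ _ _ hij).symm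
  · intro i
    refine Units.ext ?_
    have hb : (opS q τ β i * opS q τ β (i + 1) * opS q τ β i : Module.End C (WordFun Λ C)) =
        opS q τ β (i + 1) * opS q τ β i * opS q τ β (i + 1) :=
      rMatrix_braid (unit_mul_self q) _ _
    have hd : (opS q τ β i * opS q τ β (i + 1) * diag (descent (C := C) τ β i) :
        Module.End C (WordFun Λ C)) =
        diag (descent (C := C) τ β (i + 1)) * opS q τ β i * opS q τ β (i + 1) := by
      rw [mul_assoc, descent_eq, opS_mul_classDiag, ← mul_assoc, opS_mul_classDiag]
      simp only [swapAt_left, swapAt_of_ne _ (show i ≠ i + 1 by omega)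
        (show i ≠ i + 1 + 1 by omega), swapAt_of_ne _ (show i + 1 + 1 ≠ i by omega)
        (show i + 1 + 1 ≠ i + 1 by omega), descent_eq]
    push_cast
    rw [opT_val q τ hβ, opT_val q τ hβ, mul_add, add_mul, add_mul, hb, mul_smul_comm, hd,
      smul_mul_assoc, smul_mul_assoc]
  · intro i
    refine Units.ext ?_
    have hb : (opS q τ β i * opS q τ β (i + 1) * opS q τ β i : Module.End C (WordFun Λ C)) =
        opS q τ β (i + 1) * opS q τ β i * opS q τ β (i + 1) :=
      rMatrix_braid (unit_mul_self q) _ _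
    have hd : (opS q τ β (i + 1) * opS q τ β i * diag (descent (C := C) τ β (i + 1)) :
        Module.End C (WordFun Λ C)) =
        diag (descent (C := C) τ β i) * opS q τ β (i + 1) * opS q τ β i := by
      rw [mul_assoc, descent_eq, opS_mul_classDiag, ← mul_assoc, opS_mul_classDiag]
      simp only [swapAt_right, swapAt_of_ne _ (show i ≠ i + 1 by omega)
        (show i ≠ i + 1 + 1 by omega), swapAt_of_ne _ (show i + 1 + 1 ≠ i by omega)
        (show i + 1 + 1 ≠ i + 1 by omega), descent_eq]
    push_cast
    rw [opT_val q τ hβ, opT_val q τ hβ, mul_add, add_mul, add_mul, ← hb, mul_smul_comm, hd,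
      smul_mul_assoc, smul_mul_assoc]
  · intro i
    refine Units.ext ?_
    push_cast
    rw [opω_val τ, opS_mul_classDiag]
    simp only [swapAt_right, opω_val τ]
  · intro i k h₁ h₂
    rw [← Commute.units_val_iff, opT_val q τ hβ]
    exact ((hSω i k h₁ h₂).units_val).add_left ((diag_commute _ _).smul_left _)
  · intro i
    rw [← Commute.units_val_iff, opT_val q τ hβ]
    refine Commute.add_left ?_ (Commute.smul_left ?_ _)
    · push_cast
      rw [Commute, SemiconjBy, opω_val τ, opω_val τ, ← mul_assoc, opS_mul_classDiag, mul_assoc,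
        opS_mul_classDiag, ← mul_assoc, (diag_commute _ _).eq]
      simp only [swapAt_left, swapAt_right]
    · push_cast
      exact (diag_commute _ _).mul_right (diag_commute _ _)
  · intro i
    rw [← Commute.units_val_iff, opT_val q τ hβ]
    push_cast
    exact ((Commute.refl _).mul_right (Commute.refl _)).add_left ((hSD i).symm.smul_left _)

end TensorRep

/-! ### The representation on tensor space -/

section TensorRelations

variable {Λ Cl C : Type*} [LinearOrder Λ] [DecidableEq Cl] [CommRing C]

/-- The functions supported on the words whose letter at position `k` has `β`-value less
than `m`. -/
def below (C : Type*) [CommRing C] (β : Λ → ℕ) (k m : ℕ) : Submodule C (WordFun Λ C) where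
  carrier := {F | ∀ u, m ≤ β (u k) → F u = 0}
  add_mem' hF hG u hu := by rw [Pi.add_apply, hF u hu, hG u hu, add_zero]
  zero_mem' _ _ := rfl
  smul_mem' a F hF u hu := by rw [Pi.smul_apply, hF u hu, smul_zero]

variable (q : Cˣ) (τ : Λ → Cl) {β : Λ → ℕ} (hβ : Monotone β) (v : ℕ → Cˣ) (θ : Cl → Cˣ)

include hβ in
theorem opT_inv_mem_below {k m : ℕ} {F : WordFun Λ C} (hF : F ∈ below C β (k + 1) m) :
    ((opT q τ k)⁻¹ : (Module.End C (WordFun Λ C))ˣ).val F ∈ below C β k m := by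
  intro u hu
  change (rMatrix (q : C) (q - (q⁻¹ : Cˣ)) τ k -
    ((q : C) - (q⁻¹ : Cˣ)) • diag (sameClass C τ k)) F u = 0
  simp only [LinearMap.sub_apply, LinearMap.smul_apply, Pi.sub_apply, Pi.smul_apply, rMatrix_apply,
    diag_apply, sameClass, smul_eq_mul]
  rw [hF (swapAt u k) (by rwa [swapAt_right])]
  by_cases h₁ : u k = u (k + 1)
  · rw [hF u (by rwa [← h₁])]
    simp
  · by_cases h₂ : τ (u k) = τ (u (k + 1))
    · rcases lt_or_gt_of_ne h₁ with h₃ | h₃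
      · rw [hF u (hu.trans (hβ h₃.le))]
        simp
      · simp [h₁, h₂, h₃]
    · simp [h₁, h₂]

theorem opS_mem_below {k m : ℕ} {F : WordFun Λ C} (hF : F ∈ below C β k m) :
    (opS q τ β k).val F ∈ below C β (k + 1) m := by
  intro u hu
  change rMatrix (q : C) (q - (q⁻¹ : Cˣ)) (fineClass τ β) k F u = 0
  rw [rMatrix_apply, hF (swapAt u k) (by rwa [swapAt_left])]
  by_cases h₁ : u k = u (k + 1)
  · rw [hF u (by rwa [h₁])]
    simp
  · by_cases h₂ : fineClass τ β (u k) = fineClass τ β (u (k + 1))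
    · rw [hF u (by rwa [(Prod.mk.inj h₂).2])]
      simp
    · rw [if_neg h₁, if_neg fun h => h₂ h.1]
      ring

omit [LinearOrder Λ] in
theorem descent_mem_below {k m : ℕ} {F : WordFun Λ C} (hF : F ∈ below C β k (m + 1)) :
    diag (descent τ β k) F ∈ below C β (k + 1) m := by
  intro u hu
  rw [diag_apply, descent]
  split_ifs with h
  · rw [hF u (by omega), mul_zero]
  · rw [zero_mul]

include hβ in
/-- The operator representing `X_1` is triangular: on functions supported on the words whose
first letter has `β`-value at most `m` it is multiplication by `v m`, up to smaller values. -/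
theorem twistedCycle_sub_mem_below (j m : ℕ) : ∀ (k : ℕ) {F : WordFun Λ C},
    F ∈ below C β k (m + 1) →
      (twistedCycle (opT q τ) (opS q τ β) (opω β v) j k).val F - (v m : C) • F ∈
        below C β k m := by
  induction j with
  | zero =>
    intro k F hF u hu
    change (v (β (u k)) : C) * F u - (v m : C) • F u = 0
    rcases hu.eq_or_lt with h | h
    · rw [← h, smul_eq_mul, sub_self]
    · rw [hF u h, mul_zero, smul_zero, sub_zero]
  | succ j ih =>
    intro k F hF
    set Ti : Module.End C (WordFun Λ C) :=
      ((opT q τ k)⁻¹ : (Module.End C (WordFun Λ C))ˣ).val with hTi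
    set Z : Module.End C (WordFun Λ C) :=
      (twistedCycle (opT q τ) (opS q τ β) (opω β v) j (k + 1)).val
    set S : Module.End C (WordFun Λ C) := (opS q τ β k).val
    have h₁ := opT_inv_mem_below q τ hβ (ih (k + 1) (opS_mem_below q τ hF))
    have h₂ := opT_inv_mem_below q τ hβ (descent_mem_below τ hF)
    have hTS : Ti * S = 1 - ((q : C) - (q⁻¹ : Cˣ)) • (Ti * diag (descent τ β k)) := by
      have : S = (opT q τ k).val - ((q : C) - (q⁻¹ : Cˣ)) • diag (descent τ β k) := by
        rw [opT_val q τ hβ, add_sub_cancel_right]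
      rw [this, mul_sub, mul_smul_comm, hTi, Units.inv_mul]
    have e : (twistedCycle (opT q τ) (opS q τ β) (opω β v) (j + 1) k).val F - (v m : C) • F =
        Ti (Z (S F) - (v m : C) • S F) -
          (v m : C) • ((q : C) - (q⁻¹ : Cˣ)) • Ti (diag (descent τ β k) F) := by
      have hF' := LinearMap.congr_fun hTS F
      simp only [Module.End.mul_apply, LinearMap.sub_apply, LinearMap.smul_apply,
        Module.End.one_apply] at hF'
      have hZ : (twistedCycle (opT q τ) (opS q τ β) (opω β v) (j + 1) k).val F = Ti (Z (S F)) :=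
        rfl
      rw [hZ, map_sub, map_smul, hF', smul_sub]
      abel
    rw [e]
    exact Submodule.sub_mem _ h₁ (Submodule.smul_mem _ _ (Submodule.smul_mem _ _ h₂))

include hβ in
theorem ofFn_sub_prod_apply_eq_zero (j m : ℕ) : ∀ {F : WordFun Λ C}, F ∈ below C β 0 m →
    (List.ofFn fun i : Fin m => (twistedCycle (opT q τ) (opS q τ β) (opω β v) j 0).val -
      algebraMap C (Module.End C (WordFun Λ C)) (v i : C)).prod F = 0 := by
  induction m with
  | zero =>
    intro F hF
    rw [List.ofFn_zero, List.prod_nil, Module.End.one_apply]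
    ext u
    exact hF u (Nat.zero_le _)
  | succ m ih =>
    intro F hF
    rw [List.ofFn_succ_last, List.prod_append, List.prod_singleton, Module.End.mul_apply]
    exact ih (twistedCycle_sub_mem_below q τ hβ v j m 0 hF)

include hβ in
/-- The polynomial relation for the operator representing `X_1`. -/
theorem ofFn_sub_prod_eq_zero (j : ℕ) {d : ℕ} (hd : ∀ x, β x < d) :
    (List.ofFn fun i : Fin d => (twistedCycle (opT q τ) (opS q τ β) (opω β v) j 0).val -
      algebraMap C (Module.End C (WordFun Λ C)) (v i : C)).prod = 0 := by
  refine LinearMap.ext fun F => ofFn_sub_prod_apply_eq_zero q τ hβ v j d ?_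
  exact fun u hu => absurd (hd (u 0)) hu.not_gt

/-- The operators `t_k` on tensor space, acting by the value of `θ` on the letter at `k`. -/
abbrev opt (k : ℕ) : (Module.End C (WordFun Λ C))ˣ := diagUnit fun u => θ (τ (u k))

theorem opT_mul_opt (i k : ℕ) : (opT q τ i).val * (opt (Λ := Λ) τ θ k).val =
    (opt τ θ (Equiv.swap i (i + 1) k)).val * (opT q τ i).val :=
  rMatrix_mul_classDiag _ _ τ i fun c => (θ (c k) : C)

theorem opS_mul_opt (i k : ℕ) : (opS q τ β i).val * (opt (Λ := Λ) τ θ k).val =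
    (opt τ θ (Equiv.swap i (i + 1) k)).val * (opS q τ β i).val :=
  rMatrix_mul_classDiag _ _ (fineClass τ β) i fun c => (θ (c k).1 : C)

include hβ in
/-- The operators satisfy the relations of the affine algebra. The hypothesis `hθ` is the
orthogonality that makes `e_i` act as the projection to equal `t`-eigenvalues. -/
theorem tensorRelations {r n : ℕ} {ri : C} (hθr : ∀ a, (θ a : C) ^ r = 1)
    (hθ : ∀ a b, ri * ∑ s ∈ Finset.range r, (θ a : C) ^ s * (θ b : C) ^ (r - s) =
      if a = b then 1 else 0) :
    Relations r ((q : C) - (q⁻¹ : Cˣ)) ri (fun j : Fin n => (opt (Λ := Λ) τ θ j).val)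
      (fun i : Fin (n - 1) => (opT q τ i).val)
      (twistedCycle (opT q τ) (opS q τ β) (opω β v) (n - 1) 0).val
      ((twistedCycle (opT q τ) (opS q τ β) (opω β v) (n - 1) 0)⁻¹).val where
  g_comm i j hij := by
    rcases hij with hij | hij
    · exact rMatrix_comm _ _ _ _ hij
    · exact (rMatrix_comm _ _ _ _ hij).symm
  g_braid i j hij := by
    rw [hij]
    exact rMatrix_braid (unit_mul_self q) _ _
  t_comm i j := diag_commute _ _
  g_t i j := by
    rw [opT_mul_opt]
    congr 3
    rw [Equiv.swap_apply_def, simple_val]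
  t_pow i := by
    change Algebra.lmul C (WordFun Λ C) _ ^ r = 1
    rw [← map_pow, ← map_one (Algebra.lmul C (WordFun Λ C))]
    congr 1
    ext u
    exact hθr _
  g_sq i := by
    have he : idem r ri (fun j : Fin n => (opt (Λ := Λ) τ θ j).val) i =
        diag (sameClass C τ i) := by
      change ri • ∑ s ∈ Finset.range r, Algebra.lmul C (WordFun Λ C) _ ^ s *
        Algebra.lmul C (WordFun Λ C) _ ^ (r - s) = _
      simp only [← map_pow, ← map_mul, ← map_sum, ← map_smul]
      congr 1
      ext u
      simp only [Pi.smul_apply, Finset.sum_apply, Pi.mul_apply, Pi.pow_apply, smul_eq_mul, hθ]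
      rfl
    rw [he]
    exact rMatrix_sq (unit_mul_self q) _ _
  X_Xi := Units.mul_inv _
  Xi_X := Units.inv_mul _
  g_X_g_X i hi := by
    obtain ⟨m, hm⟩ : ∃ m, n - 1 = m + 1 := ⟨n - 2, by omega⟩
    rw [hi, hm]
    exact congrArg Units.val ((braidPair q τ hβ v).T_twistedCycle_T_twistedCycle m 0)
  g_X i hi := congrArg Units.val
    ((braidPair q τ hβ v).T_comm_twistedCycle (n - 1) i 0 (by omega) (by omega)).eq
  t_X j := congrArg Units.val (commute_twistedCycle (t := opt τ θ) (ω := opω β v)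
    (fun i k => Units.ext (opT_mul_opt q τ θ i k)) (fun i k => Units.ext (opS_mul_opt q τ θ i k))
    (fun i k => Units.ext (diag_commute _ _)) (n - 1) 0 j).eq

end TensorRelations

/-! ### Specialisation at `q = 1` and linear independence -/

section Specialization

variable {Λ Cl C K : Type*} [LinearOrder Λ] [DecidableEq Cl] [CommRing C] [CommRing K] (σ : C →+* K)

/-- Under `σ`, the operator `Φ` becomes the monomial operator `F ↦ (u ↦ a u * F (p u))`. -/
def Specializes (Φ : Module.End C (WordFun Λ C)) (a : (ℕ → Λ) → K) (p : (ℕ → Λ) → ℕ → Λ) : Prop :=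
  ∀ F u, σ (Φ F u) = a u * σ (F (p u))

variable {σ}

omit [LinearOrder Λ] in
theorem Specializes.mul {Φ Ψ : Module.End C (WordFun Λ C)} {a b : (ℕ → Λ) → K}
    {p p' : (ℕ → Λ) → ℕ → Λ} (h : Specializes σ Φ a p) (h' : Specializes σ Ψ b p') :
    Specializes σ (Φ * Ψ) (fun u => a u * b (p u)) (p' ∘ p) := by
  intro F u
  rw [Module.End.mul_apply, h, h', mul_assoc]
  rfl

omit [LinearOrder Λ] in
theorem Specializes.one : Specializes (Λ := Λ) σ 1 1 id := fun F u => by simp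

omit [LinearOrder Λ] in
theorem Specializes.pow {Φ : Module.End C (WordFun Λ C)} {a : (ℕ → Λ) → K}
    (h : Specializes σ Φ a id) (k : ℕ) : Specializes σ (Φ ^ k) (a ^ k) id := by
  induction k with
  | zero =>
    rw [pow_zero, pow_zero]
    exact Specializes.one
  | succ k ih =>
    rw [pow_succ, pow_succ]
    exact ih.mul h

omit [LinearOrder Λ] in
theorem Specializes.ofFn_prod {n : ℕ} : ∀ {Φ : Fin n → Module.End C (WordFun Λ C)}
    {a : Fin n → (ℕ → Λ) → K}, (∀ i, Specializes σ (Φ i) (a i) id) →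
      Specializes σ (List.ofFn Φ).prod (fun u => ∏ i, a i u) id := by
  induction n with
  | zero => 
    intro Φ a _ F u
    simp
  | succ n ih =>
    intro Φ a h
    rw [List.ofFn_succ, List.prod_cons]
    simp only [Fin.prod_univ_succ]
    exact (h 0).mul (ih fun i => h i.succ)

theorem specializes_rMatrix {q z : C} (hq : σ q = 1) (hz : σ z = 0) (cl : Λ → Cl) (i : ℕ) :
    Specializes σ (rMatrix q z cl i) 1 fun u => swapAt u i := by
  intro F u
  rw [rMatrix_apply]
  split_ifs with h₁ h₂
  · simp [swapAt_eq_self h₁, hq]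
  · simp [hz]
  · simp

theorem specializes_rUnit {q : Cˣ} (hq : σ q = 1) (cl : Λ → Cl) (i : ℕ) :
    Specializes σ (rUnit q cl i).val 1 fun u => swapAt u i := by
  have hq' : σ (q⁻¹ : Cˣ) = 1 := by
    have h := congrArg σ q.mul_inv
    rwa [map_mul, map_one, hq, one_mul] at h
  exact specializes_rMatrix hq (by rw [map_sub, hq, hq', sub_self]) cl i

theorem specializes_rUnit_inv {q : Cˣ} (hq : σ q = 1) (cl : Λ → Cl) (i : ℕ) :
    Specializes σ ((rUnit q cl i)⁻¹ : (Module.End C (WordFun Λ C))ˣ).val 1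
      fun u => swapAt u i := by
  have hq' : σ (q⁻¹ : Cˣ) = 1 := by
    have h := congrArg σ q.mul_inv
    rwa [map_mul, map_one, hq, one_mul] at h
  intro F u
  change σ ((rMatrix (q : C) (q - (q⁻¹ : Cˣ)) cl i -
    ((q : C) - (q⁻¹ : Cˣ)) • diag (sameClass C cl i)) F u) = _
  rw [LinearMap.sub_apply, LinearMap.smul_apply, Pi.sub_apply, Pi.smul_apply, smul_eq_mul, map_sub,
    map_mul, map_sub, hq, hq', sub_self, zero_mul, sub_zero]
  exact specializes_rUnit hq cl i F u

variable {q : Cˣ} {τ : Λ → Cl} {β : Λ → ℕ} {v : ℕ → Cˣ} {θ : Cl → Cˣ}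

theorem specializes_twistedCycle (hq : σ q = 1) (j : ℕ) : ∀ k,
    Specializes σ (twistedCycle (opT q τ) (opS q τ β) (opω β v) j k).val
      (fun u => σ (v (β (u k)))) id := by
  induction j with
  | zero => exact fun k F u => map_mul σ _ _
  | succ j ih =>
    intro k
    have h := ((specializes_rUnit_inv hq τ k).mul (ih (k + 1))).mul
      (specializes_rUnit hq (fineClass τ β) k)
    intro F u
    refine (h F u).trans ?_
    simp [swapAt_right, swapAt_swapAt]

theorem specializes_murphy (hq : σ q = 1) {n : ℕ} (i : ℕ) : ∀ hi : i < n,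
    Specializes σ (murphy (fun i : Fin (n - 1) => (opT q τ i).val)
      (twistedCycle (opT q τ) (opS q τ β) (opω β v) (n - 1) 0).val i hi)
      (fun u => σ (v (β (u i)))) id := by
  induction i with
  | zero => exact fun hi => specializes_twistedCycle hq (n - 1) 0
  | succ i ih =>
    intro hi F u
    refine ((((specializes_rUnit hq τ i).mul (ih (by omega))).mul
      (specializes_rUnit hq τ i)) F u).trans ?_
    simp [swapAt_left, swapAt_swapAt]

omit [LinearOrder Λ] in
/-- The word with letters `f 0, …, f (n - 1)`, continued by the letter `x`. -/
def extendWord {n : ℕ} (x : Λ) (f : Fin n → Λ) : ℕ → Λ := fun j =>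
  if h : j < n then f ⟨j, h⟩ else x

omit [LinearOrder Λ] in
theorem extendWord_val {n : ℕ} (x : Λ) (f : Fin n → Λ) (i : Fin n) : extendWord x f i = f i :=
  dif_pos i.isLt

omit [LinearOrder Λ] in
theorem extendWord_injective {n : ℕ} (x : Λ) :
    Function.Injective (extendWord x : (Fin n → Λ) → ℕ → Λ) := by
  intro f f' h
  ext i
  rw [← extendWord_val x f i, h, extendWord_val]

omit [LinearOrder Λ] in
theorem swapAt_extendWord {n : ℕ} (x : Λ) (f : Fin n → Λ) (i : Fin (n - 1)) :
    swapAt (extendWord x f) i = extendWord x (f ∘ simple i) := by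
  ext j
  by_cases hj : j < n
  · have e : Equiv.swap (i : ℕ) (i + 1) j = simple i ⟨j, hj⟩ := by
      rw [Equiv.swap_apply_def, simple_val]
    rw [swapAt, e, extendWord_val]
    exact (extendWord_val x (f ∘ simple i) ⟨j, hj⟩).symm
  · rw [swapAt_of_ne _ (by omega) (by omega), extendWord, extendWord, dif_neg hj, dif_neg hj]

theorem specializes_word (hq : σ q = 1) {n : ℕ} (l : List (Fin (n - 1))) :
    Specializes σ (l.map fun i : Fin (n - 1) => (opT q τ i).val).prod 1
      fun u => l.foldl (fun u (i : Fin (n - 1)) => swapAt u i) u := by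
  induction l with
  | nil => exact Specializes.one
  | cons i l ih =>
    intro F u
    have := (specializes_rUnit hq τ i).mul ih F u
    simpa using this

omit [LinearOrder Λ] in
theorem foldl_swapAt_extendWord {n : ℕ} (x : Λ) (l : List (Fin (n - 1))) : ∀ f : Fin n → Λ,
    l.foldl (fun u (i : Fin (n - 1)) => swapAt u i) (extendWord x f) =
      extendWord x (f ∘ (l.map simple).prod) := by
  induction l with
  | nil => intro f; rfl
  | cons i l ih =>
    intro f
    rw [List.foldl_cons, swapAt_extendWord, ih, List.map_cons, List.prod_cons]
    rfl

end Specialization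

section Grid

/-- Monomials `∏ x_i^{α_i} y_i^{β_i}` with `α_i < d`, `β_i < r` are linearly independent as
functions on a grid with `d` values of `x_i` and `r` values of `y_i`. -/
theorem eq_zero_of_forall_grid {K : Type*} [Field K] {n d r : ℕ} (x : Fin d → K) (y : Fin r → K)
    (hd : 0 < d) (hr : 0 < r) (hx : Function.Injective x) (hy : Function.Injective y)
    (c : (Fin n → Fin d) × (Fin n → Fin r) → K)
    (h : ∀ (κ : Fin n → Fin d) (ε : Fin n → Fin r),
      ∑ p, c p * ((∏ i, x (κ i) ^ (p.1 i : ℕ)) * ∏ i, y (ε i) ^ (p.2 i : ℕ)) = 0) : c = 0 := by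
  classical
  let e : (Fin n → Fin d) × (Fin n → Fin r) → (Fin n ⊕ Fin n →₀ ℕ) := fun p =>
    Finsupp.equivFunOnFinite.symm (Sum.elim (fun i => (p.1 i : ℕ)) fun i => (p.2 i : ℕ))
  have he : Function.Injective e := by
    intro p p' hpp
    have hpp' := Finsupp.equivFunOnFinite.symm.injective hpp
    refine Prod.ext (funext fun i => Fin.ext ?_) (funext fun i => Fin.ext ?_)
    · exact congrFun hpp' (Sum.inl i)
    · exact congrFun hpp' (Sum.inr i)
  have hP : ∑ p, MvPolynomial.monomial (e p) (c p) = 0 := by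
    refine MvPolynomial.eq_zero_of_eval_zero_at_prod_finset _
      (Sum.elim (fun _ => Finset.univ.image x) fun _ => Finset.univ.image y) ?_ ?_
    · have hcard : ∀ i : Fin n ⊕ Fin n, (Sum.elim (fun _ => Finset.univ.image x)
          (fun _ => Finset.univ.image y) i : Finset K).card =
            Sum.elim (fun _ => d) (fun _ => r) i := by
        rintro (i | i)
        · simp [Finset.card_image_of_injective _ hx]
        · simp [Finset.card_image_of_injective _ hy]
      intro i
      rw [hcard]
      have hpos : 0 < (Sum.elim (fun _ => d) (fun _ => r) i : ℕ) := by
        rcases i with i | i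
        · exact hd
        · exact hr
      rw [MvPolynomial.degreeOf_lt_iff hpos]
      intro m hm
      rw [MvPolynomial.mem_support_iff, MvPolynomial.coeff_sum] at hm
      obtain ⟨p, -, hp⟩ := Finset.exists_ne_zero_of_sum_ne_zero hm
      rw [MvPolynomial.coeff_monomial] at hp
      obtain rfl : e p = m := by
        by_contra hne
        exact hp (if_neg hne)
      rcases i with i | i
      · exact (p.1 i).isLt
      · exact (p.2 i).isLt
    · intro u hu
      have h₁ : ∀ i, ∃ k, x k = u (Sum.inl i) := fun i => by simpa using hu (Sum.inl i)
      have h₂ : ∀ i, ∃ k, y k = u (Sum.inr i) := fun i => by simpa using hu (Sum.inr i)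
      choose κ hκ using h₁
      choose ε hε using h₂
      rw [map_sum, ← h κ ε]
      refine Finset.sum_congr rfl fun p _ => ?_
      rw [MvPolynomial.eval_monomial, Finsupp.prod_fintype _ _ fun _ => pow_zero _,
        Fintype.prod_sum_type]
      simp [e, hκ, hε]
  ext p
  have := congrArg (MvPolynomial.coeff (e p)) hP
  rw [MvPolynomial.coeff_sum, Finset.sum_eq_single p] at this
  · simpa using this
  · intro p' _ hp'
    rw [MvPolynomial.coeff_monomial, if_neg fun h => hp' (he h)]
  · simp

end Grid

section Independence

variable {Λ C K : Type*} [LinearOrder Λ] [CommRing C] [IsDomain C] [Field K] {σ : C →+* K}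
variable {n d r : ℕ} {q : Cˣ} {τ : Λ → Fin r} {β : Λ → ℕ} {v : ℕ → Cˣ} {θ : Fin r → Cˣ}

/-- At `q = 1` the matrix of the elements `X^α t^β g_w` on suitable words is a block diagonal
matrix with tensor products of Vandermonde matrices as blocks; hence its determinant is
nonzero also for generic `q`. -/
theorem linearIndependent_tensor (hd : 0 < d) (hr : 0 < r) (hq : σ q = 1)
    (hv : Function.Injective fun i : Fin d => σ (v i)) (hθ : Function.Injective fun a => σ (θ a))
    (letter : Fin d → Fin r → Fin n → Λ) (hβ : ∀ k a c, β (letter k a c) = k)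
    (hτ : ∀ k a c, τ (letter k a c) = a)
    (hinj : ∀ k a c k' a' c', letter k a c = letter k' a' c' → c = c') (x₀ : Λ)
    (word : Equiv.Perm (Fin n) → List (Fin (n - 1))) (hword : ∀ w, ((word w).map simple).prod = w) :
    LinearIndependent C fun x : (Fin n → Fin d) × (Fin n → Fin r) × Equiv.Perm (Fin n) =>
      (List.ofFn fun i : Fin n => murphy (fun i : Fin (n - 1) => (opT q τ i).val)
        (twistedCycle (opT q τ) (opS q τ β) (opω β v) (n - 1) 0).val i i.isLt ^ (x.1 i : ℕ)).prod *
      (List.ofFn fun i : Fin n => (opt (Λ := Λ) τ θ i).val ^ (x.2.1 i : ℕ)).prod *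
      ((word x.2.2).map fun i : Fin (n - 1) => (opT q τ i).val).prod := by
  classical
  set Φ := fun x : (Fin n → Fin d) × (Fin n → Fin r) × Equiv.Perm (Fin n) =>
      (List.ofFn fun i : Fin n => murphy (fun i : Fin (n - 1) => (opT q τ i).val)
        (twistedCycle (opT q τ) (opS q τ β) (opω β v) (n - 1) 0).val i i.isLt ^ (x.1 i : ℕ)).prod *
      (List.ofFn fun i : Fin n => (opt (Λ := Λ) τ θ i).val ^ (x.2.1 i : ℕ)).prod *
      ((word x.2.2).map fun i : Fin (n - 1) => (opT q τ i).val).prod with hΦ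
  -- the colours are the positions, so that the permuted words are distinct
  let f : (Fin n → Fin d) → (Fin n → Fin r) → Fin n → Λ := fun κ ε i => letter (κ i) (ε i) i
  have hf : ∀ κ ε, Function.Injective (f κ ε) := fun κ ε i j hij => hinj _ _ _ _ _ _ hij
  let M : Matrix ((Fin n → Fin d) × (Fin n → Fin r) × Equiv.Perm (Fin n))
      ((Fin n → Fin d) × (Fin n → Fin r) × Equiv.Perm (Fin n)) C := fun ρ x =>
    Φ x (Pi.single (extendWord x₀ (f ρ.1 ρ.2.1 ∘ ρ.2.2)) 1) (extendWord x₀ (f ρ.1 ρ.2.1))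
  have hM : ∀ ρ x, σ (M ρ x) = if x.2.2 = ρ.2.2 then
      (∏ i, σ (v (ρ.1 i)) ^ (x.1 i : ℕ)) * ∏ i, σ (θ (ρ.2.1 i)) ^ (x.2.1 i : ℕ) else 0 := by
    intro ρ x
    have h₁ := ((Specializes.ofFn_prod fun i : Fin n =>
      (specializes_murphy (τ := τ) (β := β) (v := v) hq (i : ℕ) i.isLt).pow (x.1 i : ℕ)).mul
      (Specializes.ofFn_prod fun i : Fin n => Specializes.pow (σ := σ)
        (Φ := (opt (Λ := Λ) τ θ i).val) (a := fun u => σ (θ (τ (u i))))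
        (fun F u => map_mul σ _ _) (x.2.1 i : ℕ))).mul
      (specializes_word (τ := τ) hq (word x.2.2))
    have h₂ := h₁ (Pi.single (extendWord x₀ (f ρ.1 ρ.2.1 ∘ ρ.2.2)) 1)
      (extendWord x₀ (f ρ.1 ρ.2.1))
    refine h₂.trans ?_
    simp only [Function.comp_apply, id_eq, foldl_swapAt_extendWord, hword, Pi.one_apply, mul_one,
      Pi.pow_apply, extendWord_val]
    simp only [f, hβ, hτ]
    by_cases hw : x.2.2 = ρ.2.2
    · rw [if_pos hw, hw, Pi.single_eq_same, map_one, mul_one]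
    · rw [if_neg hw, Pi.single_eq_of_ne, map_zero, mul_zero]
      intro h
      refine hw (Equiv.ext fun i => hf ρ.1 ρ.2.1 ?_)
      exact congrFun (extendWord_injective x₀ h) i
  have hdet : M.det ≠ 0 := by
    intro h0
    have h1 : (σ.mapMatrix M).det = 0 := by rw [← RingHom.map_det, h0, map_zero]
    obtain ⟨c, hc, hMc⟩ := Matrix.exists_mulVec_eq_zero_iff.2 h1
    refine hc (funext fun x => ?_)
    have := eq_zero_of_forall_grid (fun i : Fin d => σ (v i)) (fun a => σ (θ a)) hd hr hv hθ
      (fun p => c (p.1, p.2, x.2.2)) fun κ ε => by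
        have h2 := congrFun hMc (κ, ε, x.2.2)
        simp only [Matrix.mulVec, dotProduct, RingHom.mapMatrix_apply, Matrix.map_apply, hM,
          Pi.zero_apply, ite_mul, zero_mul, Fintype.sum_prod_type] at h2
        rw [Fintype.sum_prod_type, ← h2]
        refine Finset.sum_congr rfl fun a _ => Finset.sum_congr rfl fun b _ => ?_
        rw [Finset.sum_ite_eq' Finset.univ x.2.2, if_pos (Finset.mem_univ _), mul_comm]
    exact congrFun this (x.1, x.2.1)
  rw [Fintype.linearIndependent_iff]
  intro c hc
  have hMc : M.mulVec c = 0 := by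
    ext ρ
    have h3 := congrFun (LinearMap.congr_fun hc (Pi.single
      (extendWord x₀ (f ρ.1 ρ.2.1 ∘ ρ.2.2)) 1)) (extendWord x₀ (f ρ.1 ρ.2.1))
    simp only [LinearMap.sum_apply, LinearMap.smul_apply, Finset.sum_apply, Pi.smul_apply,
      smul_eq_mul, LinearMap.zero_apply, Pi.zero_apply] at h3
    rw [Pi.zero_apply, ← h3]
    simp only [Matrix.mulVec, dotProduct]
    exact Finset.sum_congr rfl fun x _ => mul_comm _ _
  exact congrFun (Matrix.eq_zero_of_mulVec_eq_zero hdet hMc)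

end Independence

/-! ### The affine and the cyclotomic algebra -/

section Presentation

theorem Relations.map {A A' E E' : Type*} [CommRing A] [CommRing A'] [Ring E] [Ring E']
    [Algebra A E] [Algebra A' E'] {r n : ℕ} {z ri : A} {t : Fin n → E} {g : Fin (n - 1) → E}
    {X Xi : E} (h : Relations r z ri t g X Xi) (σ : A →+* A') (f : E →+* E')
    (hf : ∀ (a : A) (x : E), f (a • x) = σ a • f x) :
    Relations r (σ z) (σ ri) (fun j => f (t j)) (fun i => f (g i)) (f X) (f Xi) where
  g_comm i j hij := by simp only [← map_mul, h.g_comm i j hij]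
  g_braid i j hij := by simp only [← map_mul, h.g_braid i j hij]
  t_comm i j := by simp only [← map_mul, h.t_comm i j]
  g_t i j := by simp only [← map_mul, h.g_t i j]
  t_pow i := by rw [← map_pow, h.t_pow, map_one]
  g_sq i := by
    rw [← map_mul, h.g_sq]
    simp only [map_add, map_one, hf, map_mul, idem, map_sum, map_pow]
  X_Xi := by rw [← map_mul, h.X_Xi, map_one]
  Xi_X := by rw [← map_mul, h.Xi_X, map_one]
  g_X_g_X i hi := by simp only [← map_mul, h.g_X_g_X i hi]
  g_X i hi := by simp only [← map_mul, h.g_X i hi]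
  t_X j := by simp only [← map_mul, h.t_X j]

theorem map_murphy {E E' : Type*} [Ring E] [Ring E'] {n : ℕ} (f : E →+* E')
    (g : Fin (n - 1) → E) (X : E) : ∀ (i : ℕ) (hi : i < n),
      f (murphy g X i hi) = murphy (fun i => f (g i)) (f X) i hi
  | 0, _ => rfl
  | i + 1, hi => by rw [murphy, murphy, map_mul, map_mul, map_murphy f g X i (by omega)]

theorem map_ofFn_prod {E E' : Type*} [Ring E] [Ring E'] {n : ℕ} (f : E →+* E') (y : Fin n → E) :
    f (List.ofFn y).prod = (List.ofFn fun i => f (y i)).prod := by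
  rw [map_list_prod, List.map_ofFn]
  rfl

variable (r n : ℕ) (A : Type*) [CommRing A] [Algebra (BaseRing r) A]

theorem affineRelations : Relations r (algebraMap (BaseRing r) A (qSub r))
    (algebraMap (BaseRing r) A (rInv r)) (fun j => gen r n A (Gen.t j))
    (fun i => gen r n A (Gen.g i)) (gen r n A Gen.X) (gen r n A Gen.Xinv) := by
  have key : ∀ {x y : FreeAlgebra A (Gen n)}, AffineRel r n A x y →
      RingQuot.mkAlgHom A (AffineRel r n A) x = RingQuot.mkAlgHom A (AffineRel r n A) y :=
    fun h => RingQuot.mkAlgHom_rel A h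
  constructor
  · exact fun i j hij => by simpa only [gen, map_mul] using key (AffineRel.g_comm i j hij)
  · exact fun i j hij => by simpa only [gen, map_mul] using key (AffineRel.g_braid i j hij)
  · exact fun i j => by simpa only [gen, map_mul] using key (AffineRel.t_comm i j)
  · exact fun i j => by simpa only [gen, map_mul] using key (AffineRel.g_t i j)
  · exact fun i => by simpa only [gen, map_pow, map_one] using key (AffineRel.t_pow i)
  · intro i
    have := key (AffineRel.g_sq i)
    simpa only [gen, idem, map_pow, map_add, map_one, map_smul, map_mul, freeE, map_sum,
      pow_two] using this
  · simpa only [gen, map_mul, map_one] using key AffineRel.X_Xinv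
  · simpa only [gen, map_mul, map_one] using key AffineRel.Xinv_X
  · exact fun i hi => by simpa only [gen, map_mul] using key (AffineRel.g_X_g_X i hi)
  · exact fun i hi => by simpa only [gen, map_mul] using key (AffineRel.g_X i hi)
  · exact fun j => by simpa only [gen, map_mul] using key (AffineRel.t_X j)

/-- The generators of the affine algebra mapped to given elements of an algebra. -/
def genValue {E : Type*} {n : ℕ} (t : Fin n → E) (g : Fin (n - 1) → E) (X Xi : E) : Gen n → E
  | Gen.t j => t j
  | Gen.g i => g i
  | Gen.X => X
  | Gen.Xinv => Xi

variable {r n A}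

/-- The universal property of the affine Yokonuma-Hecke algebra. -/
theorem Relations.exists_algHom {E : Type*} [Ring E] [Algebra A E] {t : Fin n → E}
    {g : Fin (n - 1) → E} {X Xi : E} (h : Relations r (algebraMap (BaseRing r) A (qSub r))
      (algebraMap (BaseRing r) A (rInv r)) t g X Xi) :
    ∃ Ψ : Affine r n A →ₐ[A] E, ∀ x, Ψ (gen r n A x) = genValue t g X Xi x := by
  have hrel : ∀ ⦃x y : FreeAlgebra A (Gen n)⦄, AffineRel r n A x y →
      FreeAlgebra.lift A (genValue t g X Xi) x = FreeAlgebra.lift A (genValue t g X Xi) y := by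
    intro x y hxy
    induction hxy with
    | g_comm i j hij => simpa [genValue] using h.g_comm i j hij
    | g_braid i j hij => simpa [genValue] using h.g_braid i j hij
    | t_comm i j => simpa [genValue] using h.t_comm i j
    | g_t i j => simpa [genValue] using h.g_t i j
    | t_pow i => simpa [genValue] using h.t_pow i
    | g_sq i =>
      simpa only [map_pow, map_add, map_one, map_smul, map_mul, freeE, map_sum, pow_two,
        FreeAlgebra.lift_ι_apply, genValue, idem] using h.g_sq i
    | X_Xinv => simpa [genValue] using h.X_Xi
    | Xinv_X => simpa [genValue] using h.Xi_X
    | g_X_g_X i hi => simpa [genValue] using h.g_X_g_X i hi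
    | g_X i hi => simpa [genValue] using h.g_X i hi
    | t_X j => simpa [genValue] using h.t_X j
  refine ⟨RingQuot.liftAlgHom A ⟨_, hrel⟩, fun x => ?_⟩
  rw [gen, RingQuot.liftAlgHom_mkAlgHom_apply, FreeAlgebra.lift_ι_apply]

theorem xElem_eq_murphy : ∀ (i : ℕ) (hi : i < n), xElem r n A i hi =
    murphy (fun i => gen r n A (Gen.g i)) (gen r n A Gen.X) i hi
  | 0, _ => rfl
  | i + 1, hi => by rw [xElem, murphy, xElem_eq_murphy i (by omega)]

/-- The image of `X^α t^β g_w` under a homomorphism. -/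
theorem map_monomial {E : Type*} [Ring E] (f : Affine r n A →+* E) (α β : Fin n → ℕ)
    (l : List (Fin (n - 1))) : f (xMonomial r n A α * tMonomial r n A β * gWord r n A l) =
      (List.ofFn fun i : Fin n => murphy (fun i => f (gen r n A (Gen.g i)))
        (f (gen r n A Gen.X)) i i.isLt ^ α i).prod *
      (List.ofFn fun i : Fin n => f (gen r n A (Gen.t i)) ^ β i).prod *
      (l.map fun i => f (gen r n A (Gen.g i))).prod := by
  rw [map_mul, map_mul, xMonomial, tMonomial, gWord, map_ofFn_prod, map_ofFn_prod, map_list_prod,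
    List.map_map]
  simp only [map_pow, xElem_eq_murphy, map_murphy]
  rfl

variable (r n A)

theorem adjoin_gen : Algebra.adjoin A (Set.range (gen r n A)) = ⊤ := by
  have h := congrArg (Subalgebra.map (RingQuot.mkAlgHom A (AffineRel r n A)))
    (FreeAlgebra.adjoin_range_ι A (Gen n))
  rw [AlgHom.map_adjoin, ← Set.range_comp, Algebra.map_top,
    (AlgHom.range_eq_top _).2 (RingQuot.mkAlgHom_surjective A _)] at h
  exact h

variable {d : ℕ} (v : Fin d → Aˣ)

/-- The canonical map to the cyclotomic algebra as a homomorphism of `A`-algebras. -/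
noncomputable def toCyclotomicAlg : Affine r n A →ₐ[A] Cyclotomic r n A v :=
  { toCyclotomic r n A v with commutes' := fun _ => rfl }

theorem toCyclotomicAlg_surjective : Function.Surjective (toCyclotomicAlg r n A v) :=
  RingCon.mk'_surjective _

theorem cyclotomicRelations : Relations r (algebraMap (BaseRing r) A (qSub r))
    (algebraMap (BaseRing r) A (rInv r)) (fun j => toCyclotomic r n A v (gen r n A (Gen.t j)))
    (fun i => toCyclotomic r n A v (gen r n A (Gen.g i))) (toCyclotomic r n A v (gen r n A Gen.X))
    (toCyclotomic r n A v (gen r n A Gen.Xinv)) :=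
  (affineRelations r n A).map (RingHom.id A) (toCyclotomic r n A v) fun _ _ => rfl

theorem adjoin_cyclotomic : Algebra.adjoin A
    (Set.range (fun j => toCyclotomic r n A v (gen r n A (Gen.t j))) ∪
      Set.range (fun i => toCyclotomic r n A v (gen r n A (Gen.g i))) ∪
      {toCyclotomic r n A v (gen r n A Gen.X), toCyclotomic r n A v (gen r n A Gen.Xinv)}) = ⊤ := by
  have h := congrArg (Subalgebra.map (toCyclotomicAlg r n A v)) (adjoin_gen r n A)
  rw [AlgHom.map_adjoin, ← Set.range_comp, Algebra.map_top,
    (AlgHom.range_eq_top _).2 (toCyclotomicAlg_surjective r n A v)] at h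
  rw [eq_top_iff, ← h]
  refine Algebra.adjoin_mono ?_
  rintro _ ⟨x, rfl⟩
  cases x with
  | t j => exact Or.inl (Or.inl ⟨j, rfl⟩)
  | g i => exact Or.inl (Or.inr ⟨i, rfl⟩)
  | X => exact Or.inr (Or.inl rfl)
  | Xinv => exact Or.inr (Or.inr rfl)

theorem toCyclotomic_fOne : toCyclotomic r n A v (fOne r n A v) = 0 :=
  (RingCon.eq _).2 ((TwoSidedIdeal.mem_iff _ _).1 (TwoSidedIdeal.subset_span rfl))

theorem map_fOne_eq_ofFn_prod {E : Type*} [Ring E] (f : Affine r n A →+* E) :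
    f (fOne r n A v) = (List.ofFn fun i : Fin d =>
      f (gen r n A Gen.X) - f (algebraMap A (Affine r n A) (v i : A))).prod := by
  simp only [fOne, map_ofFn_prod, map_sub]

/-- The image of `f_1` is the value of the polynomial `∏ (x - v_i)`. -/
theorem map_fOne {E : Type*} [Ring E] [Algebra A E] (f : Affine r n A →ₐ[A] E) :
    f (fOne r n A v) = Polynomial.aeval (f (gen r n A Gen.X))
      (∏ i, (Polynomial.X - Polynomial.C (v i : A))) := by
  rw [fOne, ← List.prod_ofFn, map_list_prod, map_list_prod, List.map_ofFn, List.map_ofFn]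
  congr 2
  ext i
  simp

variable {r n A v}

theorem eq_zero_of_toCyclotomic_eq_zero {E : Type*} [Ring E] (Ψ : Affine r n A →+* E)
    (hΨ : Ψ (fOne r n A v) = 0) {x : Affine r n A} (hx : toCyclotomic r n A v x = 0) : Ψ x = 0 := by
  have hmem : x ∈ TwoSidedIdeal.span {fOne r n A v} := (RingCon.eq _).1 hx
  have hle : TwoSidedIdeal.span {fOne r n A v} ≤ TwoSidedIdeal.ker Ψ :=
    TwoSidedIdeal.span_le.2 (Set.singleton_subset_iff.2 ((TwoSidedIdeal.mem_ker Ψ).2 hΨ))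
  exact (TwoSidedIdeal.mem_ker Ψ).1 (hle hmem)

/-- Linear independence in the cyclotomic algebra can be checked in any algebra to which the
affine algebra maps with `f_1` going to `0`. -/
theorem linearIndependent_toCyclotomic {ι E : Type*} [Fintype ι] [Ring E] [Algebra A E]
    (Ψ : Affine r n A →ₐ[A] E) (hΨ : Ψ (fOne r n A v) = 0) (x : ι → Affine r n A)
    (h : LinearIndependent A fun j => Ψ (x j)) :
    LinearIndependent A fun j => toCyclotomic r n A v (x j) := by
  rw [Fintype.linearIndependent_iff] at h ⊢
  intro c hc
  refine h c ?_
  have h0 : toCyclotomicAlg r n A v (∑ j, c j • x j) = 0 := by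
    rw [map_sum, ← hc]
    exact Finset.sum_congr rfl fun j _ => map_smul _ _ _
  have := eq_zero_of_toCyclotomic_eq_zero Ψ.toRingHom hΨ h0
  change Ψ (∑ j, c j • x j) = 0 at this
  rw [← this, map_sum]
  exact Finset.sum_congr rfl fun j _ => (map_smul _ _ _).symm

theorem span_monomials_eq_top (hr : 0 < r) (hn : 0 < n) (hd : 0 < d)
    {word : Equiv.Perm (Fin n) → List (Fin (n - 1))} (hword : ∀ w, IsReducedWord w (word w)) :
    Submodule.span A (Set.range
      fun x : (Fin n → Fin d) × (Fin n → Fin r) × Equiv.Perm (Fin n) =>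
        toCyclotomic r n A v (xMonomial r n A (fun i => (x.1 i : ℕ)) *
          tMonomial r n A (fun i => (x.2.1 i : ℕ)) * gWord r n A (word x.2.2))) = ⊤ := by
  rcases subsingleton_or_nontrivial A with hA | hA
  · have := Module.subsingleton A (Cyclotomic r n A v)
    exact Subsingleton.elim _ _
  have h := cyclotomicRelations r n A v
  simp only [map_monomial]
  set X := toCyclotomic r n A v (gen r n A Gen.X)
  set Xi := toCyclotomic r n A v (gen r n A Gen.Xinv)
  set p : Polynomial A := ∏ i, (Polynomial.X - Polynomial.C (v i : A)) with hp
  have hmonic : p.Monic := Polynomial.monic_prod_X_sub_C _ _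
  have hdeg : p.natDegree = d := by
    rw [hp, Polynomial.natDegree_finsetProd_X_sub_C_eq_card]
    simp
  have hpX : Polynomial.aeval X p = 0 :=
    (map_fOne r n A v (toCyclotomicAlg r n A v)).symm.trans (toCyclotomic_fOne r n A v)
  refine h.span_eq_top hr hn hd hword ?_ ?_ (adjoin_cyclotomic r n A v)
  · rw [hmonic.as_sum, hdeg, map_add, map_pow, Polynomial.aeval_X, map_sum] at hpX
    rw [eq_neg_of_add_eq_zero_left hpX]
    refine Submodule.neg_mem _ (Submodule.sum_mem _ fun k hk => ?_)
    rw [← Polynomial.smul_eq_C_mul, map_smul, map_pow, Polynomial.aeval_X]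
    exact Submodule.smul_mem _ _ (Submodule.subset_span ⟨k, Finset.mem_range.1 hk, rfl⟩)
  · -- the constant term of the polynomial relation is invertible
    have hunit : IsUnit (p.coeff 0) := by
      rw [Polynomial.coeff_zero_eq_eval_zero, hp, Polynomial.eval_prod]
      refine IsUnit.prod_univ_iff.2 fun i => ?_
      simp
    obtain ⟨c, hc⟩ := hunit
    have hmul : X * Polynomial.aeval X p.divX = -algebraMap A _ (c : A) := by
      rw [← Polynomial.X_mul_divX_add p, map_add, map_mul, Polynomial.aeval_X, Polynomial.aeval_C,
        ← hc] at hpX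
      exact eq_neg_of_add_eq_zero_left hpX
    have hXi : Xi = Polynomial.aeval X (-(Polynomial.C ((c⁻¹ : Aˣ) : A)) * p.divX) := by
      have h1 : Polynomial.aeval X p.divX = Xi * -algebraMap A _ (c : A) := by
        rw [← hmul, ← mul_assoc, h.Xi_X, one_mul]
      rw [map_mul, h1, map_neg, Polynomial.aeval_C, neg_mul, ← mul_assoc,
        Algebra.commutes, mul_assoc, mul_neg, mul_neg, neg_neg, ← map_mul, Units.inv_mul, map_one,
        mul_one]
    rw [hXi]
    exact Polynomial.aeval_mem_adjoin_singleton A X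

end Presentation

/-! ### The universal parameter ring -/

section Universal

/-- Laurent polynomials in indeterminates `v_1, …, v_d` over `ℤ[1/r][q, q⁻¹, ζ]`. -/
abbrev UnivRing (r d : ℕ) : Type := AddMonoidAlgebra (BaseRing r) (Fin d → ℤ)

variable (r d : ℕ)

/-- The indeterminate `v_i` as a unit. -/
noncomputable def univUnit (i : Fin d) : (UnivRing r d)ˣ :=
  Units.map (AddMonoidAlgebra.of (BaseRing r) (Fin d → ℤ))
    (toUnits (Multiplicative.ofAdd (Pi.single i (1 : ℤ))))

/-- The primitive root of unity `ζ` in `ℤ[1/r, ζ]`. -/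
noncomputable def zeta : CycInt r :=
  ⟨_, Algebra.subset_adjoin (Set.mem_insert_of_mem _ rfl)⟩

variable {r d}

theorem zeta_pow (hr : 0 < r) : zeta r ^ r = 1 :=
  Subtype.ext (Complex.isPrimitiveRoot_exp r hr.ne').pow_eq_one

/-- `ζ` as a unit. -/
noncomputable def zetaUnit (hr : 0 < r) : (CycInt r)ˣ :=
  Units.ofPowEqOne (zeta r) r (zeta_pow hr) hr.ne'

/-- Orthogonality of the powers of `ζ`. -/
theorem sum_zeta (hr : 0 < r) (a b : Fin r) :
    (⟨(r : ℂ)⁻¹, Algebra.subset_adjoin (Set.mem_insert _ _)⟩ : CycInt r) *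
      ∑ s ∈ Finset.range r, (zeta r ^ (a : ℕ)) ^ s * (zeta r ^ (b : ℕ)) ^ (r - s) =
        if a = b then 1 else 0 := by
  have hprim := Complex.isPrimitiveRoot_exp r hr.ne'
  have hr0 : (r : ℂ) ≠ 0 := Nat.cast_ne_zero.2 hr.ne'
  have hz : ((zeta r : CycInt r) : ℂ) = Complex.exp (2 * (Real.pi : ℂ) * Complex.I / (r : ℂ)) := rfl
  rw [← hz] at hprim
  refine Subtype.ext ?_
  rw [MulMemClass.coe_mul, AddSubmonoidClass.coe_finsetSum]
  simp only [MulMemClass.coe_mul, SubmonoidClass.coe_pow]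
  set w : ℂ := ((zeta r : CycInt r) : ℂ)
  have hw : w ≠ 0 := hprim.ne_zero hr.ne'
  set y : ℂ := w ^ (a : ℕ) * (w ^ (b : ℕ))⁻¹ with hy
  have hyr : y ^ r = 1 := by
    rw [hy, mul_pow, inv_pow, ← pow_mul, ← pow_mul, mul_comm (a : ℕ), mul_comm (b : ℕ), pow_mul,
      pow_mul, hprim.pow_eq_one, one_pow, one_pow, inv_one, mul_one]
  have hterm : ∀ s ∈ Finset.range r, (w ^ (a : ℕ)) ^ s * (w ^ (b : ℕ)) ^ (r - s) = y ^ s := by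
    intro s hs
    have hbr : (w ^ (b : ℕ)) ^ r = 1 := by
      rw [← pow_mul, mul_comm, pow_mul, hprim.pow_eq_one, one_pow]
    rw [pow_sub₀ _ (pow_ne_zero _ hw) (Finset.mem_range.1 hs).le, hbr, one_mul, hy, mul_pow,
      inv_pow]
  rw [Finset.sum_congr rfl hterm]
  split_ifs with hab
  · have : y = 1 := by rw [hy, hab, mul_inv_cancel₀ (pow_ne_zero _ hw)]
    simp [this, hr0]
  · have hne : y ≠ 1 := by
      intro h
      rw [hy, mul_inv_eq_one₀ (pow_ne_zero _ hw)] at h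
      exact hab (Fin.ext (hprim.pow_inj a.isLt b.isLt h))
    have hgeom := geom_sum_mul y r
    rw [hyr, sub_self] at hgeom
    rw [(mul_eq_zero.1 hgeom).resolve_right (sub_ne_zero.2 hne), mul_zero]
    rfl

/-- The homomorphism `k ↦ ∏ v_i^{k_i}`. -/
def unitMonomial {A : Type*} [CommRing A] (v : Fin d → Aˣ) : Multiplicative (Fin d → ℤ) →* A where
  toFun k := ((∏ i, v i ^ k.toAdd i : Aˣ) : A)
  map_one' := by simp
  map_mul' k l := by
    rw [← Units.val_mul, ← Finset.prod_mul_distrib]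
    simp only [toAdd_mul, Pi.add_apply, zpow_add]

theorem unitMonomial_single {A : Type*} [CommRing A] (v : Fin d → Aˣ) (i : Fin d) :
    unitMonomial v (Multiplicative.ofAdd (Pi.single i (1 : ℤ))) = v i := by
  change ((∏ j, v j ^ (Pi.single i (1 : ℤ) : Fin d → ℤ) j : Aˣ) : A) = v i
  rw [Finset.prod_eq_single i]
  · simp
  · intro j _ hj
    simp [Pi.single_eq_of_ne hj]
  · simp

/-- The homomorphism from the universal ring given by invertible elements of an algebra. -/
noncomputable def univHom {A : Type*} [CommRing A] [Algebra (BaseRing r) A] (v : Fin d → Aˣ) :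
    UnivRing r d →ₐ[BaseRing r] A :=
  AddMonoidAlgebra.lift (BaseRing r) A (Fin d → ℤ) (unitMonomial v)

theorem univHom_univUnit {A : Type*} [CommRing A] [Algebra (BaseRing r) A] (v : Fin d → Aˣ)
    (i : Fin d) : univHom v (univUnit r d i : UnivRing r d) = v i :=
  (AddMonoidAlgebra.lift_of (unitMonomial v) _).trans (unitMonomial_single v i)

/-- The homomorphism `q ↦ 1` to the complex numbers. -/
noncomputable def evalOne (r : ℕ) : BaseRing r →+* ℂ :=
  AddMonoidAlgebra.liftNCRingHom (Subalgebra.val _ : CycInt r →ₐ[ℤ] ℂ).toRingHom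
    (1 : Multiplicative ℤ →* ℂ) fun _ _ => Commute.all _ _

theorem evalOne_C_mul_T (x : CycInt r) (k : ℤ) :
    evalOne r (LaurentPolynomial.C x * LaurentPolynomial.T k) = x := by
  rw [← LaurentPolynomial.single_eq_C_mul_T]
  exact (AddMonoidAlgebra.liftNCRingHom_single _ _ _ _ _).trans (mul_one _)

theorem evalOne_C (x : CycInt r) : evalOne r (LaurentPolynomial.C x) = x := by
  rw [← mul_one (LaurentPolynomial.C x), ← LaurentPolynomial.T_zero, evalOne_C_mul_T]

theorem evalOne_T (k : ℤ) : evalOne r (LaurentPolynomial.T k) = 1 := by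
  rw [← one_mul (LaurentPolynomial.T k), ← map_one LaurentPolynomial.C, evalOne_C_mul_T]
  rfl

/-- The specialisation `q = 1`, `v_i = i + 1`. The values of the `v_i` only have to be distinct
and nonzero. -/
noncomputable def specialize (r d : ℕ) : UnivRing r d →+* ℂ :=
  AddMonoidAlgebra.liftNCRingHom (evalOne r)
    (unitMonomial fun i : Fin d => Units.mk0 ((i : ℕ) + 1 : ℂ) (Nat.cast_add_one_ne_zero _))
    fun _ _ => Commute.all _ _

theorem specialize_algebraMap (x : BaseRing r) :
    specialize r d (algebraMap (BaseRing r) (UnivRing r d) x) = evalOne r x := by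
  refine (AddMonoidAlgebra.liftNCRingHom_single _ _ _ _ _).trans ?_
  rw [ofAdd_zero, map_one, mul_one]
  rfl

theorem specialize_univUnit (i : Fin d) : specialize r d (univUnit r d i) = (i : ℕ) + 1 := by
  refine (AddMonoidAlgebra.liftNCRingHom_single _ _ _ _ _).trans ?_
  rw [map_one, one_mul]
  exact unitMonomial_single _ i

end Universal

/-! ### The basis -/

section Basis

open scoped TensorProduct

variable {r n d : ℕ} {B : Type*} [CommRing B] [Algebra (BaseRing r) B]

/-- Linear independence of the elements `X^α t^β g_w` over a domain that specialises to `q = 1`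
and distinct values of the `v_i`. -/
theorem linearIndependent_of_specialization [IsDomain B] (σ : B →+* ℂ)
    (hσ : ∀ x, σ (algebraMap (BaseRing r) B x) = evalOne r x) (u : Fin d → Bˣ)
    (hu : Function.Injective fun i => σ (u i)) (hr : 0 < r) (hn : 0 < n) (hd : 0 < d)
    (word : Equiv.Perm (Fin n) → List (Fin (n - 1))) (hword : ∀ w, ((word w).map simple).prod = w) :
    LinearIndependent B
      fun x : (Fin n → Fin d) × (Fin n → Fin r) × Equiv.Perm (Fin n) =>
        toCyclotomic r n B u
          (xMonomial r n B (fun i => (x.1 i : ℕ)) * tMonomial r n B (fun i => (x.2.1 i : ℕ)) *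
            gWord r n B (word x.2.2)) := by
  -- letters carry an eigenvalue index of `X_1`, an eigenvalue index of `t_1` and a colour
  let Λ : Type := Fin d ×ₗ Fin r ×ₗ Fin n
  let β : Λ → ℕ := fun x => (ofLex x).1
  let τ : Λ → Fin r := fun x => (ofLex (ofLex x).2).1
  have hβ : Monotone β := fun x y hxy => Prod.Lex.monotone_fst x y hxy
  let ψ : CycInt r →+* B :=
    (algebraMap (BaseRing r) B).comp LaurentPolynomial.C
  let q : Bˣ := Units.map (algebraMap (BaseRing r) B).toMonoidHom
    ⟨LaurentPolynomial.T 1, LaurentPolynomial.T (-1),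
      by rw [← LaurentPolynomial.T_add]; exact LaurentPolynomial.T_zero,
      by rw [← LaurentPolynomial.T_add]; exact LaurentPolynomial.T_zero⟩
  let θ : Fin r → Bˣ := fun a => Units.map ψ.toMonoidHom (zetaUnit hr ^ (a : ℕ))
  let v : ℕ → Bˣ := fun i => if h : i < d then u ⟨i, h⟩ else 1
  have hv : ∀ i : Fin d, v i = u i := fun i => dif_pos i.isLt
  have hθ : ∀ a, (θ a : B) = ψ (zeta r ^ (a : ℕ)) := fun a => rfl
  have hrel := tensorRelations (r := r) (n := n) q τ hβ v θ
    (ri := algebraMap (BaseRing r) B (rInv r))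
    (fun a => by
      rw [hθ, ← map_pow, ← pow_mul, mul_comm (a : ℕ) r, pow_mul, zeta_pow hr, one_pow, map_one])
    (fun a b => by
      have h := congrArg ψ (sum_zeta hr a b)
      rw [map_mul, map_sum, apply_ite ψ, map_one, map_zero] at h
      rw [← h]
      simp only [hθ, map_mul, map_pow]
      rfl)
  have hz : ((q : B) - (q⁻¹ : Bˣ)) =
      algebraMap (BaseRing r) B (qSub r) := by
    rw [qSub, map_sub]
    rfl
  rw [hz] at hrel
  obtain ⟨Ψ, hΨ⟩ := hrel.exists_algHom
  refine linearIndependent_toCyclotomic Ψ ?_ _ ?_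
  · have h := ofFn_sub_prod_eq_zero q τ hβ v (n - 1) (d := d) fun x => (ofLex x).1.isLt
    refine (map_fOne_eq_ofFn_prod r n B u Ψ.toRingHom).trans (Eq.trans ?_ h)
    simp only [AlgHom.toRingHom_eq_coe, RingHom.coe_coe, AlgHom.commutes, hΨ, genValue, hv]
  · have hli := linearIndependent_tensor (σ := σ) (q := q) (τ := τ) (β := β) (v := v)
      (θ := θ) hd hr ((hσ _).trans (evalOne_T 1)) (fun i j hij => by
        simp only [hv] at hij
        exact hu hij) (fun a b hab => by
        have h : ∀ a, σ (θ a) = (zeta r : ℂ) ^ (a : ℕ) := fun a => by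
          rw [hθ]
          exact (hσ _).trans ((evalOne_C _).trans rfl)
        simp only [h] at hab
        exact Fin.ext ((Complex.isPrimitiveRoot_exp r hr.ne').pow_inj a.isLt b.isLt hab))
      (fun k a c => toLex (k, toLex (a, c))) (fun _ _ _ => rfl) (fun _ _ _ => rfl)
      (fun k a c k' a' c' h => (Prod.mk.inj (Prod.mk.inj h).2).2)
      (toLex (⟨0, hd⟩, toLex (⟨0, hr⟩, ⟨0, hn⟩))) word hword
    convert hli using 2 with x
    have := map_monomial Ψ.toRingHom (fun i => (x.1 i : ℕ)) (fun i => (x.2.1 i : ℕ)) (word x.2.2)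
    refine this.trans ?_
    simp only [AlgHom.toRingHom_eq_coe, RingHom.coe_coe, hΨ, genValue]
    all_goals rfl

/-- Linear independence is preserved by base change, because the elements also span. -/
theorem linearIndependent_of_baseChange {A : Type*} [CommRing A] [Algebra (BaseRing r) A]
    [Algebra B A] [IsScalarTower (BaseRing r) B A] (hr : 0 < r) (hn : 0 < n) (hd : 0 < d)
    {u : Fin d → Bˣ} {v : Fin d → Aˣ} (huv : ∀ i, algebraMap B A (u i) = v i)
    {word : Equiv.Perm (Fin n) → List (Fin (n - 1))} (hword : ∀ w, IsReducedWord w (word w))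
    (hli : LinearIndependent B fun x : (Fin n → Fin d) × (Fin n → Fin r) × Equiv.Perm (Fin n) =>
      toCyclotomic r n B u (xMonomial r n B (fun i => (x.1 i : ℕ)) *
        tMonomial r n B (fun i => (x.2.1 i : ℕ)) * gWord r n B (word x.2.2))) :
    LinearIndependent A fun x : (Fin n → Fin d) × (Fin n → Fin r) × Equiv.Perm (Fin n) =>
      toCyclotomic r n A v (xMonomial r n A (fun i => (x.1 i : ℕ)) *
        tMonomial r n A (fun i => (x.2.1 i : ℕ)) * gWord r n A (word x.2.2)) := by
  let Y := Cyclotomic r n B u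
  let b : Module.Basis ((Fin n → Fin d) × (Fin n → Fin r) × Equiv.Perm (Fin n)) B Y :=
    Module.Basis.mk hli (span_monomials_eq_top hr hn hd hword).ge
  let f : Y →+* TensorProduct B A Y :=
    (Algebra.TensorProduct.includeRight : Y →ₐ[B] TensorProduct B A Y).toRingHom
  have hrel := (cyclotomicRelations r n B u).map (algebraMap B A) f fun a x => by
    change (1 : A) ⊗ₜ[B] (a • x) = algebraMap B A a • ((1 : A) ⊗ₜ[B] x)
    rw [TensorProduct.tmul_smul, algebraMap_smul]
  have hbase : ∀ x, algebraMap B A (algebraMap (BaseRing r) B x) = algebraMap (BaseRing r) A x :=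
    fun x => (IsScalarTower.algebraMap_apply (BaseRing r) B A x).symm
  rw [hbase, hbase] at hrel
  obtain ⟨Ψ, hΨ⟩ := hrel.exists_algHom
  refine linearIndependent_toCyclotomic Ψ ?_ _ ?_
  · have h := (map_fOne_eq_ofFn_prod r n B u (f.comp (toCyclotomic r n B u))).symm.trans
      ((congrArg f (toCyclotomic_fOne r n B u)).trans (map_zero f))
    have hscalar : ∀ i, algebraMap A (TensorProduct B A Y) (v i) =
        f (toCyclotomic r n B u (algebraMap B (Affine r n B) (u i))) := by
      intro i
      rw [← huv]
      change (algebraMap B A (u i : B)) ⊗ₜ[B] (1 : Y) = (1 : A) ⊗ₜ[B] (algebraMap B Y (u i : B))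
      rw [Algebra.algebraMap_eq_smul_one, Algebra.algebraMap_eq_smul_one, TensorProduct.smul_tmul]
    refine (map_fOne_eq_ofFn_prod r n A v Ψ.toRingHom).trans (Eq.trans ?_ h)
    simp only [AlgHom.toRingHom_eq_coe, RingHom.coe_coe, AlgHom.commutes, hΨ, genValue, hscalar,
      RingHom.comp_apply]
  · convert (b.baseChange A).linearIndependent using 2 with x
    rw [Module.Basis.baseChange_apply, Module.Basis.mk_apply]
    have h₁ := map_monomial Ψ.toRingHom (fun i => (x.1 i : ℕ)) (fun i => (x.2.1 i : ℕ))
      (word x.2.2)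
    have h₂ := map_monomial (f.comp (toCyclotomic r n B u)) (fun i => (x.1 i : ℕ))
      (fun i => (x.2.1 i : ℕ)) (word x.2.2)
    refine h₁.trans (Eq.trans ?_ h₂.symm)
    simp only [AlgHom.toRingHom_eq_coe, RingHom.coe_coe, hΨ, genValue, RingHom.comp_apply]
    all_goals rfl

/-- Linear independence over an arbitrary algebra, by base change from the universal ring. -/
theorem linearIndependent_monomials (hr : 0 < r) (hn : 0 < n) (hd : 0 < d) {A : Type*} [CommRing A]
    [Algebra (BaseRing r) A] (v : Fin d → Aˣ) (word : Equiv.Perm (Fin n) → List (Fin (n - 1)))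
    (hword : ∀ w, IsReducedWord w (word w)) :
    LinearIndependent A fun x : (Fin n → Fin d) × (Fin n → Fin r) × Equiv.Perm (Fin n) =>
      toCyclotomic r n A v (xMonomial r n A (fun i => (x.1 i : ℕ)) *
        tMonomial r n A (fun i => (x.2.1 i : ℕ)) * gWord r n A (word x.2.2)) := by
  let _ : Algebra (UnivRing r d) A :=
    (univHom v : UnivRing r d →ₐ[BaseRing r] A).toRingHom.toAlgebra
  have : IsScalarTower (BaseRing r) (UnivRing r d) A :=
    IsScalarTower.of_algebraMap_eq (R := BaseRing r) (S := UnivRing r d) (A := A)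
      fun x => ((univHom v).commutes x).symm
  refine linearIndependent_of_baseChange (B := UnivRing r d) hr hn hd (univHom_univUnit v) hword
    (linearIndependent_of_specialization (B := UnivRing r d) (specialize r d)
      specialize_algebraMap (univUnit r d) ?_ hr hn hd word fun w => (hword w).1)
  intro i j hij
  simpa [specialize_univUnit, Fin.ext_iff] using hij

end Basis

end YokonumaHecke

theorem theorem2p7 (r n d : ℕ) (hr : 1 ≤ r) (hn : 1 ≤ n) (hd : 1 ≤ d)
    (A : Type*) [CommRing A] [Nontrivial A] [Algebra (YokonumaHecke.BaseRing r) A]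
    (v : Fin d → Aˣ)
    (word : Equiv.Perm (Fin n) → List (Fin (n - 1)))
    (hword : ∀ w, YokonumaHecke.IsReducedWord w (word w)) :
    (∃ b : Module.Basis ((Fin n → Fin d) × (Fin n → Fin r) × Equiv.Perm (Fin n)) A
        (YokonumaHecke.Cyclotomic r n A v),
      ∀ (α : Fin n → Fin d) (β : Fin n → Fin r) (w : Equiv.Perm (Fin n)),
        b (α, β, w) = YokonumaHecke.toCyclotomic r n A v
          (YokonumaHecke.xMonomial r n A (fun i => (α i : ℕ)) *
            YokonumaHecke.tMonomial r n A (fun i => (β i : ℕ)) *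
            YokonumaHecke.gWord r n A (word w))) ∧
    Module.Free A (YokonumaHecke.Cyclotomic r n A v) ∧
    Module.finrank A (YokonumaHecke.Cyclotomic r n A v) = (r * d) ^ n * n.factorial := by
  let b := Module.Basis.mk
    (YokonumaHecke.linearIndependent_monomials hr hn hd v word hword)
    (YokonumaHecke.span_monomials_eq_top hr hn hd hword).ge
  refine ⟨⟨b, fun α β w => Module.Basis.mk_apply _ _ _⟩, Module.Free.of_basis b, ?_⟩
  rw [Module.finrank_eq_card_basis b]
  simp only [Fintype.card_prod, Fintype.card_fun, Fintype.card_fin, Fintype.card_perm]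
  rw [mul_pow]
  ring
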